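/- Let $0<\alpha\le 1$, $\beta>1$, $\gamma>0$ and $\lambda\in\mathbb R$. Let $\gamma_0$ be the Euler--Mascheroni constant and let $$E^{g}_{a,b}(z)=\sum_{k=0}^{\infty}\frac{(g)_k\,z^k}{k!\,\Gamma(a k+b)},\qquad (g)_k=g(g+1)\cdots(g+k-1),$$ be the Prabhakar function ($a,b>0$, $g\in\mathbb R$). For $0<\alpha<1$ and $t_1,t_2>0$ put $$\Phi_{\alpha,0}(t_1,t_2)=\frac1\pi\int_0^{\infty}\exp\bigl(-u t_1-t_2u^{\alpha}\cos(\pi\alpha)\bigr)\,\sin\bigl(t_2u^{\alpha}\sin(\pi\alpha)\bigr)\,du ,$$ and for $\alpha=1$ let $\Phi_{1,0}(t_1,t_2)=\delta(t_1-t_2)$ be the delta function, so that $\int_0^\infty\Phi_{1,0}(t_1,t_2)f(t_2)\,dt_2=f(t_1)$. Then for every $t\ge 0$ the function $g\mapsto t^{\beta-1}E^{g}_{\alpha,\beta}(\lambda t^{\alpha})$ is differentiable at $g=\gamma$, and $$\begin{aligned}\frac{\partial}{\partial\gamma}\Bigl(t^{\beta-1}E^{\gamma}_{\alpha,\beta}(\lambda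 t^{\alpha})\Bigr)={}&-\alpha\int_0^t\bigl(\ln(t-t_1)+\gamma_0\bigr)\,t_1^{\beta-2}E^{\gamma}_{\alpha,\beta-1}(\lambda t_1^{\alpha})\,dt_1\\&+\int_0^t(t-t_1)^{\beta-\alpha-1}E^{\gamma-1}_{\alpha,\beta-\alpha}\bigl(\lambda(t-t_1)^{\alpha}\bigr)\left(\int_0^{\infty}\Phi_{\alpha,0}(t_1,t_2)\,e^{\lambda t_2}(\ln t_2+\gamma_0)\,dt_2\right)dt_1 .\end{aligned}$$ All the integrals involved converge absolutely (for $\alpha<1$ the integral defining $\Phi_{\alpha,0}(t_1,t_2)$ for all $t_1,t_2>0$, and the inner integral over $t_2$ for all $t_1>0$). -/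

import Mathlib

/-- The Prabhakar (three-parametric Mittag-Leffler) function
`E^γ_{α,β}(z) = ∑ₖ (γ)ₖ zᵏ / (k! Γ(α k + β))`, where `(γ)ₖ = γ (γ + 1) ⋯ (γ + k - 1)`. -/
noncomputable def prabhakar (α β γ z : ℝ) : ℝ :=
  ∑' k : ℕ, (ascPochhammer ℝ k).eval γ * z ^ k / ((k.factorial : ℝ) * Real.Gamma (α * k + β))

/-- The integrand, in the variable `u`, of the integral that defines the kernel `Φ_{a,b}(t, t')`. -/
noncomputable def efrosKernelIntegrand (a b t t' u : ℝ) : ℝ :=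
  Real.sin (t' * u ^ a * Real.sin (Real.pi * a) + Real.pi * b) /
    (u ^ b * Real.exp (u * t + t' * u ^ a * Real.cos (Real.pi * a)))

/-- The kernel `Φ_{a,b}(t, t')` for `0 < a < 1`: the inverse Laplace transform in `t` of
`s ↦ s^{-b} exp (-t' s^a)`, written as a real integral over the branch cut. -/
noncomputable def efrosKernel (a b t t' : ℝ) : ℝ :=
  Real.pi⁻¹ * (∫ u in Set.Ioi (0 : ℝ), efrosKernelIntegrand a b t t' u) +
    (if b = 1 then 1 else 0)

/-- The integral `∫₀^∞ Φ_{a,0}(t, t') f(t') dt'` for `0 < a ≤ 1`. For `a = 1` the kernel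
`Φ_{1,0}(t, t')` is the delta function `δ(t - t')`, so that the integral is `f(t)`. -/
noncomputable def efrosTransform (a : ℝ) (f : ℝ → ℝ) (t : ℝ) : ℝ :=
  if a = 1 then f t else ∫ t' in Set.Ioi (0 : ℝ), efrosKernel a 0 t t' * f t'

/-! Everything is expanded in powers of `lam`, with coefficients built from the Riemann–Liouville
kernels h_a(t) = t^(a-1)/Γ(a) and their order derivatives h'_a = ∂h_a/∂a. The Prabhakar function
becomes t^(β-1) E^g(λ t^α) = Σ (g)_k/k! λ^k h_{αk+β}(t), and the derivative in g may be taken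
termwise.

On the right-hand side, the Beta integral says h_a * h_b = h_{a+b}, and differentiating in the order
gives h_a * h'_b = h'_{a+b}. Since ψ(1) = -γ₀, the function ln t + γ₀ is exactly h'_1, so the first
convolution is -α Σ (γ)_k/k! λ^k h'_{αk+β}(t).

For the second one needs the moments of the kernel, ∫ Φ(t,x) x^p dx = Γ(p+1) h_{α(p+1)}(t).
Differentiating in p produces the logarithmic moments, and the inner integral is Σ λ^n (H_n
h_{α(n+1)} + α h'_{α(n+1)}), with H_n the harmonic numbers. Convolving with the Prabhakar series of
parameter γ-1 and collecting powers of λ leaves two finite sums. Chu–Vandermonde gives Σ (γ-1)_j/j!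
= (γ)_N/N! over j ≤ N, and its derivative in the second parameter gives Σ (γ-1)_j/j! H_{N-j} = d/dγ
(γ)_N/N!. The h' terms then cancel against the first convolution, and the derivative series remains.

The moments come from Fubini, for which the oscillating integral defining Φ is unsuitable. It is
replaced by the imaginary part of an integral of e^{ts - x s^α} along a ray s = c + v e^{iφ} with φ
obtuse and αφ acute, which decays both in v and in x. The two forms agree because their power series
in x agree: one by the Gamma integral and reflection, the other by Hankel's formula for 1/Γ.
Hankel's formula is proved on rays by calculus, without deforming contours. -/

section

open MeasureTheory Set Filter Topology

/-! ### Digamma and the Riemann–Liouville kernels -/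

/-- The logarithmic derivative of the real Gamma function. -/
noncomputable def realDigamma (x : ℝ) : ℝ := deriv Real.Gamma x / Real.Gamma x

/-- The Riemann–Liouville kernel `t ^ (a - 1) / Γ(a)`. -/
noncomputable def rlKernel (a t : ℝ) : ℝ := t ^ (a - 1) / Real.Gamma a

/-- The derivative of the Riemann–Liouville kernel with respect to its order. -/
noncomputable def rlKernelDeriv (a t : ℝ) : ℝ := rlKernel a t * (Real.log t - realDigamma a)

theorem differentiableAt_Gamma_of_pos {x : ℝ} (hx : 0 < x) : DifferentiableAt ℝ Real.Gamma x :=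
  Real.differentiableAt_Gamma fun m => by
    have : (0 : ℝ) ≤ m := m.cast_nonneg
    linarith

theorem hasDerivAt_log_Gamma {x : ℝ} (hx : 0 < x) :
    HasDerivAt (Real.log ∘ Real.Gamma) (realDigamma x) x :=
  (differentiableAt_Gamma_of_pos hx).hasDerivAt.log (Real.Gamma_pos_of_pos hx).ne'

theorem deriv_log_Gamma {x : ℝ} (hx : 0 < x) : deriv (Real.log ∘ Real.Gamma) x = realDigamma x :=
  (hasDerivAt_log_Gamma hx).deriv

theorem realDigamma_mono {x y : ℝ} (hx : 0 < x) (hxy : x ≤ y) : realDigamma x ≤ realDigamma y := by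
  rw [← deriv_log_Gamma hx, ← deriv_log_Gamma (hx.trans_le hxy)]
  exact Real.convexOn_log_Gamma.monotoneOn_deriv
    (fun z hz => (hasDerivAt_log_Gamma hz).differentiableAt) hx (hx.trans_le hxy) hxy

/-- By convexity the tangent slope of log Γ at x is at most its chord slope over [x, x+1], which is
log x by the functional equation. -/
theorem realDigamma_le {x : ℝ} (hx : 0 < x) : realDigamma x ≤ x := by
  have h := Real.convexOn_log_Gamma.le_slope_of_hasDerivAt (x := x) (y := x + 1) hx
    (by simp; linarith) (by linarith) (hasDerivAt_log_Gamma hx)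
  rw [slope_def_field] at h
  have hG := Real.Gamma_pos_of_pos hx
  simp only [Function.comp, Real.Gamma_add_one hx.ne', Real.log_mul hx.ne' hG.ne'] at h
  have := Real.log_le_sub_one_of_pos hx
  have e : (x + 1 - x) = 1 := by ring
  rw [e] at h
  linarith

/-- Monotonicity bounds ψ below. The resulting linear growth is what dominates the order derivatives
in the series. -/
theorem abs_realDigamma_le {a x : ℝ} (ha : 0 < a) (hx : a ≤ x) :
    |realDigamma x| ≤ |realDigamma a| + x := by
  have h1 := realDigamma_mono ha hx
  have h2 := realDigamma_le (ha.trans_le hx)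
  rw [abs_le]
  constructor
  · linarith [neg_abs_le (realDigamma a)]
  · linarith [abs_nonneg (realDigamma a)]

theorem realDigamma_nat_add_one (n : ℕ) :
    realDigamma (n + 1) = harmonic n - Real.eulerMascheroniConstant := by
  rw [realDigamma, Real.deriv_Gamma_nat, Real.Gamma_nat_eq_factorial]
  have : (n.factorial : ℝ) ≠ 0 := by positivity
  field_simp
  ring

/-- This is where the Euler–Mascheroni constant enters: ψ(1) = -γ₀. -/
theorem rlKernelDeriv_one (t : ℝ) :
    rlKernelDeriv 1 t = Real.log t + Real.eulerMascheroniConstant := by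
  have := realDigamma_nat_add_one 0
  simp at this
  simp [rlKernelDeriv, rlKernel, this]

theorem hasDerivAt_rlKernel {a t : ℝ} (ha : 0 < a) (ht : 0 < t) :
    HasDerivAt (fun b => rlKernel b t) (rlKernelDeriv a t) a := by
  have h1 : HasDerivAt (fun b : ℝ => t ^ (b - 1)) (Real.log t * 1 * t ^ (a - 1)) a :=
    ((hasDerivAt_id a).sub_const 1).const_rpow ht
  have hG := (Real.Gamma_pos_of_pos ha).ne'
  have := h1.div (differentiableAt_Gamma_of_pos ha).hasDerivAt hG
  refine this.congr_deriv ?_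
  simp only [rlKernelDeriv, rlKernel, realDigamma]
  field_simp

/-! ### Growth of Gamma and elementary integrability -/

/-- Log-convexity: the chord slope of log Γ over [x-1, x] is log(x-1), and it is at most the slope
over [x, x+a]. -/
theorem Gamma_mul_rpow_le {a x : ℝ} (ha : 0 < a) (hx : 1 < x) :
    Real.Gamma x * (x - 1) ^ a ≤ Real.Gamma (x + a) := by
  have hx0 : 0 < x := by linarith
  have hx1 : 0 < x - 1 := by linarith
  have h := Real.convexOn_log_Gamma.slope_mono_adjacent (x := x - 1) (y := x) (z := x + a) hx1
    (by simp; linarith) (by linarith) (by linarith)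
  have hG := Real.Gamma_pos_of_pos hx1
  have e : Real.Gamma x = (x - 1) * Real.Gamma (x - 1) := by
    rw [← Real.Gamma_add_one hx1.ne']; ring_nf
  have e1 : x - (x - 1) = 1 := by ring
  have e2 : x + a - x = a := by ring
  have hl : (Real.log ∘ Real.Gamma) x - (Real.log ∘ Real.Gamma) (x - 1) = Real.log (x - 1) := by
    simp only [Function.comp, e, Real.log_mul hx1.ne' hG.ne']; ring
  rw [hl, e1, e2, div_one, le_div_iff₀ ha] at h
  simp only [Function.comp] at h
  have hGx := Real.Gamma_pos_of_pos hx0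
  have hGa := Real.Gamma_pos_of_pos (by linarith : 0 < x + a)
  rw [← Real.log_le_log_iff (by positivity) hGa, Real.log_mul hGx.ne' (by positivity),
    Real.log_rpow hx1]
  linarith

/-- Ratio test: consecutive Gamma values grow by at least (ak+b-1)^a, which tends to infinity. -/
theorem summable_pow_div_Gamma {a b x : ℝ} (ha : 0 < a) (hb : 0 < b) (hx : 0 ≤ x) :
    Summable fun k : ℕ => x ^ k / Real.Gamma (a * k + b) := by
  rcases hx.eq_or_lt with rfl | hx
  · exact summable_of_ne_finset_zero (s := {0}) fun k hk => by
      simp at hk; simp [hk]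
  have hpos : ∀ k : ℕ, 0 < Real.Gamma (a * k + b) := fun k =>
    Real.Gamma_pos_of_pos (by positivity)
  have hlim : Tendsto (fun k : ℕ => (a * k + b - 1) ^ a) atTop atTop := by
    refine (tendsto_rpow_atTop ha).comp ?_
    refine Tendsto.atTop_add (Tendsto.atTop_add ?_ tendsto_const_nhds) tendsto_const_nhds
    exact tendsto_natCast_atTop_atTop.const_mul_atTop ha
  have hlin : Tendsto (fun k : ℕ => a * (k : ℝ) + b) atTop atTop :=
    Tendsto.atTop_add (tendsto_natCast_atTop_atTop.const_mul_atTop ha) tendsto_const_nhds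
  refine summable_of_ratio_norm_eventually_le (r := 1 / 2) (by norm_num) ?_
  filter_upwards [hlim.eventually_ge_atTop (2 * x), hlin.eventually_gt_atTop 1] with k hk hk1
  have h := Gamma_mul_rpow_le ha hk1
  have e : a * ((k + 1 : ℕ) : ℝ) + b = a * k + b + a := by push_cast; ring
  rw [Real.norm_of_nonneg (by have := hpos (k + 1); positivity),
    Real.norm_of_nonneg (by have := hpos k; positivity), e]
  have hG := hpos k
  have hG' := hpos (k + 1)
  rw [e] at hG'
  rw [pow_succ, div_le_iff₀ hG']
  have : Real.Gamma (a * k + b) * (2 * x) ≤ Real.Gamma (a * k + b + a) :=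
    (mul_le_mul_of_nonneg_left hk hG.le).trans h
  calc x ^ k * x = 1 / 2 * (x ^ k / Real.Gamma (a * k + b)) * (Real.Gamma (a * k + b) * (2 * x)) := by
        field_simp
    _ ≤ _ := by gcongr

theorem abs_log_le_rpow {x : ℝ} {e : ℝ} (he : 0 < e) (hx : 0 < x) :
    |Real.log x| ≤ x ^ (-e) / e + x := by
  rcases le_total x 1 with h | h
  · have := Real.abs_log_mul_self_rpow_lt x e hx h he
    have hp : 0 < x ^ e := Real.rpow_pos_of_pos hx _
    rw [abs_mul, abs_of_pos hp] at this
    rw [Real.rpow_neg hx.le]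
    have : |Real.log x| ≤ (x ^ e)⁻¹ / e := by
      rw [div_eq_mul_inv, ← div_eq_inv_mul, le_div_iff₀ hp]
      simpa using this.le
    linarith
  · rw [abs_of_nonneg (Real.log_nonneg h)]
    have := Real.log_le_sub_one_of_pos hx
    have : 0 ≤ x ^ (-e) / e := by positivity
    linarith

theorem integrableOn_rpow_mul_exp_neg {p k : ℝ} (hp : -1 < p) (hk : 0 < k) :
    IntegrableOn (fun x : ℝ => x ^ p * Real.exp (-k * x)) (Ioi 0) := by
  have := integrableOn_rpow_mul_exp_neg_mul_rpow (p := 1) (s := p) (b := k) hp one_pos hk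
  simpa using this

theorem integrableOn_exp_neg_mul_abs_log {k c : ℝ} (hk : 0 < k) :
    IntegrableOn (fun x : ℝ => Real.exp (-k * x) * (|Real.log x| + c)) (Ioi 0) := by
  have h1 := integrableOn_rpow_mul_exp_neg (p := -(1/2)) (by norm_num) hk
  have h2 := integrableOn_rpow_mul_exp_neg (p := 1) (by norm_num) hk
  have h3 := integrableOn_rpow_mul_exp_neg (p := 0) (by norm_num) hk
  have h4 := ((h1.const_mul 2).add h2).add (h3.const_mul |c|)
  refine Integrable.mono' h4 (by fun_prop) ?_
  filter_upwards [self_mem_ae_restrict measurableSet_Ioi] with x hx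
  have := abs_log_le_rpow (e := 1/2) (by norm_num) hx
  rw [norm_mul, Real.norm_of_nonneg (Real.exp_pos _).le, Real.norm_eq_abs]
  have h5 : |(|Real.log x| + c)| ≤ x ^ (-(1/2) : ℝ) / (1/2) + x + |c| := by
    refine (abs_add_le _ _).trans ?_
    rw [abs_abs]; linarith
  simp only [Pi.add_apply, Real.rpow_zero, Real.rpow_one]
  calc _ ≤ Real.exp (-k * x) * (x ^ (-(1/2) : ℝ) / (1/2) + x + |c|) := by gcongr
    _ = _ := by ring

/-! ### Convolution of Riemann–Liouville kernels -/

/-- The function `s ↦ (t - s) ^ (a - 1)` on `(0, t)`, extended by zero. -/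
noncomputable def betaWeight (a t : ℝ) : ℝ → ℂ :=
  (Ioo 0 t).indicator fun s => (((t - s) ^ (a - 1) : ℝ) : ℂ)

theorem integrable_betaWeight {a t : ℝ} (ha : 0 < a) (ht : 0 < t) :
    Integrable (betaWeight a t) := by
  have h := (intervalIntegral.intervalIntegrable_rpow' (a := 0) (b := t) (r := a - 1)
    (by linarith)).comp_sub_left t
  rw [sub_zero, sub_self] at h
  have h2 := (intervalIntegrable_iff_integrableOn_Ioo_of_le ht.le).1 h.symm
  have h3 : IntegrableOn (fun s => (((t - s) ^ (a - 1) : ℝ) : ℂ)) (Ioo 0 t) := Integrable.ofReal h2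
  exact h3.integrable_indicator measurableSet_Ioo

theorem mellin_betaWeight {a b t : ℝ} (ha : 0 < a) (hb : 0 < b) (ht : 0 < t) :
    mellin (betaWeight a t) b =
      ((Real.Gamma a * Real.Gamma b * rlKernel (a + b) t : ℝ) : ℂ) := by
  have h := Complex.betaIntegral_scaled b a ht
  rw [intervalIntegral.integral_of_le ht.le, integral_Ioc_eq_integral_Ioo,
    Complex.betaIntegral_eq_Gamma_mul_div _ _ (by simpa) (by simpa)] at h
  have e : mellin (betaWeight a t) b =
      ∫ x in Ioo 0 t, (x : ℂ) ^ ((b : ℂ) - 1) * ((t : ℂ) - x) ^ ((a : ℂ) - 1) := by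
    rw [mellin, ← integral_indicator measurableSet_Ioi, ← integral_indicator measurableSet_Ioo]
    congr 1
    ext x
    by_cases hx : x ∈ Ioo 0 t
    · have hx' : 0 ≤ t - x := by linarith [hx.2]
      rw [indicator_of_mem (show x ∈ Ioi 0 from hx.1), indicator_of_mem hx, betaWeight,
        indicator_of_mem hx, smul_eq_mul, Complex.ofReal_cpow hx']
      push_cast
      rfl
    · rw [indicator_of_notMem hx, indicator_apply_eq_zero]
      intro _
      rw [betaWeight, indicator_of_notMem hx, smul_zero]
  rw [e, h]
  simp only [rlKernel]
  push_cast [Complex.ofReal_cpow ht.le, ← Complex.Gamma_ofReal]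
  rw [add_comm (a : ℂ) b]
  ring

/-- Differentiating a Mellin transform in its variable inserts a logarithm. Comparison with the
derivative of the closed form `mellin_betaWeight` evaluates the integral. -/
theorem mellin_log_betaWeight {a b t : ℝ} (ha : 0 < a) (hb : 0 < b) (ht : 0 < t) :
    MellinConvergent (betaWeight a t) b ∧
    MellinConvergent (fun s => Real.log s • betaWeight a t s) b ∧
    mellin (fun s => Real.log s • betaWeight a t s) b =
      ((Real.Gamma a * (Real.Gamma b * rlKernelDeriv (a + b) t +
        deriv Real.Gamma b * rlKernel (a + b) t) : ℝ) : ℂ) := by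
  have hloc : LocallyIntegrableOn (betaWeight a t) (Ioi 0) :=
    (integrable_betaWeight ha ht).locallyIntegrable.locallyIntegrableOn _
  have htop : betaWeight a t =O[atTop] (fun x : ℝ => x ^ (-(b + 1))) := by
    refine Asymptotics.IsBigO.of_bound 0 ?_
    filter_upwards [eventually_ge_atTop t] with x hx
    rw [betaWeight, indicator_of_notMem (fun h => absurd h.2 (not_lt.2 hx))]
    simp
  have hbot : betaWeight a t =O[𝓝[>] 0] (fun x : ℝ => x ^ (-(0 : ℝ))) := by
    have hc : Tendsto (fun s : ℝ => (((t - s) ^ (a - 1) : ℝ) : ℂ)) (𝓝[>] 0)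
        (𝓝 (((t - 0) ^ (a - 1) : ℝ) : ℂ)) := by
      refine Tendsto.mono_left ?_ nhdsWithin_le_nhds
      refine (Complex.continuous_ofReal.tendsto _).comp ?_
      have h0 : ContinuousAt (fun s : ℝ => (t - s) ^ (a - 1)) 0 :=
        (continuousAt_const.sub continuousAt_id).rpow_const (Or.inl (by simpa using ht.ne'))
      exact h0
    have h1 := hc.isBigO_one ℝ
    simp only [neg_zero, Real.rpow_zero]
    refine (Asymptotics.isBigO_congr ?_ EventuallyEq.rfl).1 h1
    filter_upwards [Ioo_mem_nhdsGT ht] with x hx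
    rw [betaWeight, indicator_of_mem hx]
  have key := mellin_hasDerivAt_of_isBigO_rpow (s := (b : ℂ)) hloc htop (by simp) hbot
    (by simpa using hb)
  have hconv := mellinConvergent_of_isBigO_rpow (s := (b : ℂ)) hloc htop (by simp) hbot
    (by simpa using hb)
  refine ⟨hconv, key.1, ?_⟩
  have h1 := key.2.comp_ofReal
  have h2 : HasDerivAt (fun x : ℝ =>
      ((Real.Gamma a * Real.Gamma x * rlKernel (a + x) t : ℝ) : ℂ))
      ((Real.Gamma a * (Real.Gamma b * rlKernelDeriv (a + b) t +
        deriv Real.Gamma b * rlKernel (a + b) t) : ℝ) : ℂ) b := by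
    refine HasDerivAt.ofReal_comp (f := fun x => Real.Gamma a * Real.Gamma x * rlKernel (a + x) t)
      (u := Real.Gamma a * (Real.Gamma b * rlKernelDeriv (a + b) t +
        deriv Real.Gamma b * rlKernel (a + b) t)) ?_
    have h3 := (hasDerivAt_rlKernel (a := a + b) (by linarith) ht).comp_const_add a b
    have h4 := ((differentiableAt_Gamma_of_pos hb).hasDerivAt.const_mul (Real.Gamma a)).mul h3
    refine h4.congr_deriv ?_
    ring
  refine h1.unique (h2.congr_of_eventuallyEq ?_)
  filter_upwards [lt_mem_nhds hb] with x hx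
  exact mellin_betaWeight ha hx ht

theorem mellin_ofReal_indicator {f g : ℝ → ℝ} {F : ℝ → ℂ} {b t : ℝ}
    (hF : ∀ s, F s = (Ioo 0 t).indicator (fun s => (f s : ℂ)) s)
    (hg : ∀ s ∈ Ioo 0 t, g s = s ^ (b - 1) * f s) (hc : MellinConvergent F b) :
    IntegrableOn g (Ioo 0 t) ∧ mellin F b = ((∫ s in Ioo 0 t, g s : ℝ) : ℂ) := by
  have e : ∀ s ∈ Ioo 0 t, (s : ℂ) ^ ((b : ℂ) - 1) • F s = (g s : ℂ) := by
    intro s hs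
    rw [hF, indicator_of_mem hs, hg s hs, smul_eq_mul]
    push_cast [Complex.ofReal_cpow hs.1.le]
    rfl
  constructor
  · have h1 : IntegrableOn (fun s : ℝ => (s : ℂ) ^ ((b : ℂ) - 1) • F s) (Ioo 0 t) :=
      hc.mono_set Ioo_subset_Ioi_self
    have h2 := h1.congr_fun e measurableSet_Ioo
    exact h2.re
  · rw [← integral_complex_ofReal, mellin, ← integral_indicator measurableSet_Ioi,
      ← integral_indicator measurableSet_Ioo]
    congr 1
    ext s
    by_cases hs : s ∈ Ioo 0 t
    · rw [indicator_of_mem (show s ∈ Ioi 0 from hs.1), indicator_of_mem hs, e s hs]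
    · rw [indicator_of_notMem hs, indicator_apply_eq_zero]
      intro _
      rw [hF, indicator_of_notMem hs, smul_zero]

theorem integral_rlKernel_mul_rlKernel {a b t : ℝ} (ha : 0 < a) (hb : 0 < b) (ht : 0 < t) :
    IntegrableOn (fun s => rlKernel a (t - s) * rlKernel b s) (Ioo 0 t) ∧
      ∫ s in Ioo 0 t, rlKernel a (t - s) * rlKernel b s = rlKernel (a + b) t := by
  have h := mellin_ofReal_indicator (F := betaWeight a t) (f := fun s => (t - s) ^ (a - 1))
    (g := fun s => s ^ (b - 1) * (t - s) ^ (a - 1)) (fun _ => rfl) (fun _ _ => rfl)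
    (mellin_log_betaWeight ha hb ht).1
  rw [mellin_betaWeight ha hb ht, Complex.ofReal_inj] at h
  have hGa := (Real.Gamma_pos_of_pos ha).ne'
  have hGb := (Real.Gamma_pos_of_pos hb).ne'
  have e : (fun s => rlKernel a (t - s) * rlKernel b s) = fun s =>
      (Real.Gamma a * Real.Gamma b)⁻¹ * (s ^ (b - 1) * (t - s) ^ (a - 1)) := by
    ext s
    simp only [rlKernel]
    field_simp
  rw [e]
  refine ⟨h.1.const_mul _, ?_⟩
  rw [integral_const_mul, ← h.2]
  field_simp

theorem integral_rlKernel_mul_rlKernelDeriv {a b t : ℝ} (ha : 0 < a) (hb : 0 < b) (ht : 0 < t) :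
    IntegrableOn (fun s => rlKernel a (t - s) * rlKernelDeriv b s) (Ioo 0 t) ∧
      ∫ s in Ioo 0 t, rlKernel a (t - s) * rlKernelDeriv b s = rlKernelDeriv (a + b) t := by
  obtain ⟨-, hc, hm⟩ := mellin_log_betaWeight ha hb ht
  have h := mellin_ofReal_indicator (f := fun s => Real.log s * (t - s) ^ (a - 1)) (t := t)
    (g := fun s => s ^ (b - 1) * (Real.log s * (t - s) ^ (a - 1))) (fun s => by
      by_cases hs : s ∈ Ioo 0 t <;> simp [betaWeight, hs]) (fun _ _ => rfl) hc
  rw [hm, Complex.ofReal_inj] at h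
  obtain ⟨h1, h2⟩ := integral_rlKernel_mul_rlKernel ha hb ht
  have hGa := (Real.Gamma_pos_of_pos ha).ne'
  have hGb := (Real.Gamma_pos_of_pos hb).ne'
  have e : (fun s => rlKernel a (t - s) * rlKernelDeriv b s) = fun s =>
      (Real.Gamma a * Real.Gamma b)⁻¹ * (s ^ (b - 1) * (Real.log s * (t - s) ^ (a - 1))) -
        realDigamma b * (rlKernel a (t - s) * rlKernel b s) := by
    ext s
    simp only [rlKernelDeriv, rlKernel]
    field_simp
  rw [e]
  refine ⟨(h.1.const_mul _).sub (h1.const_mul _), ?_⟩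
  rw [integral_sub (h.1.const_mul _) (h1.const_mul _), integral_const_mul, integral_const_mul,
    ← h.2, h2]
  rw [realDigamma]
  field_simp
  ring

/-! ### The Gamma integral with complex rate -/

theorem norm_cexp_neg_mul_ofReal (r : ℂ) (v : ℝ) :
    ‖Complex.exp (-(r * v))‖ = Real.exp (-r.re * v) := by
  rw [Complex.norm_exp]
  simp

theorem integrableOn_rpow_mul_cexp {a : ℝ} (ha : 0 < a) {r : ℂ} (hr : 0 < r.re) :
    IntegrableOn (fun v : ℝ => ((v ^ (a - 1) : ℝ) : ℂ) * Complex.exp (-(r * v))) (Ioi 0) := by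
  refine Integrable.mono' (integrableOn_rpow_mul_exp_neg (p := a - 1) (by linarith) hr)
    (by fun_prop) ?_
  filter_upwards [self_mem_ae_restrict measurableSet_Ioi] with v hv
  rw [norm_mul, norm_cexp_neg_mul_ofReal, Complex.norm_real,
    Real.norm_of_nonneg (Real.rpow_nonneg (le_of_lt hv) _)]

theorem differentiableAt_integral_rpow_mul_cexp {a : ℝ} (ha : 0 < a) {r₀ : ℂ} (hr : 0 < r₀.re) :
    DifferentiableAt ℂ
      (fun r : ℂ => ∫ v in Ioi (0 : ℝ), ((v ^ (a - 1) : ℝ) : ℂ) * Complex.exp (-(r * v))) r₀ := by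
  have hopen : {r : ℂ | r₀.re / 2 < r.re} ∈ 𝓝 r₀ :=
    (isOpen_lt continuous_const Complex.continuous_re).mem_nhds (by simp; linarith)
  refine (hasDerivAt_integral_of_dominated_loc_of_deriv_le (μ := volume.restrict (Ioi (0 : ℝ)))
    (F := fun (r : ℂ) (v : ℝ) => ((v ^ (a - 1) : ℝ) : ℂ) * Complex.exp (-(r * v)))
    (F' := fun r v => ((v ^ (a - 1) : ℝ) : ℂ) * (Complex.exp (-(r * v)) * (-(1 * (v : ℂ)))))
    (bound := fun v : ℝ => v ^ a * Real.exp (-(r₀.re / 2) * v)) hopen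
    (Eventually.of_forall fun r => by fun_prop)
    (integrableOn_rpow_mul_cexp ha hr) (by fun_prop) ?_
    (integrableOn_rpow_mul_exp_neg (by linarith) (by linarith)) ?_).2.differentiableAt
  · filter_upwards [self_mem_ae_restrict measurableSet_Ioi] with v hv r hr
    have hv0 : 0 < v := hv
    rw [norm_mul, norm_mul, norm_cexp_neg_mul_ofReal, Complex.norm_real,
      Real.norm_of_nonneg (Real.rpow_nonneg hv0.le _)]
    have e : v ^ a = v ^ (a - 1) * v := by
      rw [← Real.rpow_add_one hv0.ne']; ring_nf
    have e2 : ‖(-(1 * (v : ℂ)))‖ = v := by simp [abs_of_pos hv0]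
    have h3 : Real.exp (-r.re * v) ≤ Real.exp (-(r₀.re / 2) * v) := by
      apply Real.exp_le_exp.2
      have : r₀.re / 2 < r.re := hr
      nlinarith
    rw [e, e2]
    calc v ^ (a - 1) * (Real.exp (-r.re * v) * v)
        ≤ v ^ (a - 1) * (Real.exp (-(r₀.re / 2) * v) * v) := by gcongr
      _ = _ := by ring
  · refine Eventually.of_forall fun v r _ => ?_
    exact (((hasDerivAt_id r).mul_const (v : ℂ)).neg.cexp).const_mul _

/-- The Gamma integral `∫₀^∞ v ^ (a - 1) exp (-r v) dv` for complex `r` with positive real part. -/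
theorem integral_rpow_mul_cexp {a : ℝ} (ha : 0 < a) {r : ℂ} (hr : 0 < r.re) :
    ∫ v in Ioi (0 : ℝ), ((v ^ (a - 1) : ℝ) : ℂ) * Complex.exp (-(r * v)) =
      Real.Gamma a * r ^ (-(a : ℂ)) := by
  set U : Set ℂ := {r : ℂ | 0 < r.re} with hU
  have hUo : IsOpen U := isOpen_lt continuous_const Complex.continuous_re
  have hUc : IsPreconnected U := (convex_halfSpace_re_gt 0).isPreconnected
  have hf : AnalyticOnNhd ℂ
      (fun r : ℂ => ∫ v in Ioi (0 : ℝ), ((v ^ (a - 1) : ℝ) : ℂ) * Complex.exp (-(r * v))) U :=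
    DifferentiableOn.analyticOnNhd (fun z hz =>
      (differentiableAt_integral_rpow_mul_cexp ha hz).differentiableWithinAt) hUo
  have hg : AnalyticOnNhd ℂ (fun r : ℂ => Real.Gamma a * r ^ (-(a : ℂ))) U :=
    DifferentiableOn.analyticOnNhd (fun z hz =>
      ((differentiableAt_id.cpow_const (Or.inl hz)).const_mul _).differentiableWithinAt) hUo
  -- Identity theorem on the right half-plane: both sides are analytic there and agree at the real
  -- points near 1.
  refine hf.eqOn_of_preconnected_of_frequently_eq hg hUc (z₀ := 1) (by simp [hU]) ?_ hr
  have ht : Tendsto (fun x : ℝ => (x : ℂ)) (𝓝[≠] 1) (𝓝[≠] 1) := by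
    refine tendsto_nhdsWithin_iff.2 ⟨?_, ?_⟩
    · exact (Complex.continuous_ofReal.tendsto' 1 1 (by simp)).mono_left nhdsWithin_le_nhds
    · filter_upwards [self_mem_nhdsWithin] with x hx
      simpa using hx
  refine ht.frequently (Eventually.frequently ?_)
  filter_upwards [nhdsWithin_le_nhds (lt_mem_nhds (zero_lt_one (α := ℝ)))] with x hx
  have h := Real.integral_rpow_mul_exp_neg_mul_Ioi ha hx
  have e : (1 / x) ^ a = x ^ (-a) := by
    rw [one_div, Real.inv_rpow hx.le, Real.rpow_neg hx.le]
  rw [e] at h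
  have h2 := congrArg (fun y : ℝ => (y : ℂ)) h
  rw [← integral_complex_ofReal] at h2
  push_cast [Complex.ofReal_cpow hx.le] at h2
  rw [h2, mul_comm]

/-! ### Geometry of rays -/

/-- The point `c + v exp (iφ)` of a ray that starts at `c`. -/
noncomputable def rayPoint (φ c v : ℝ) : ℂ := c + v * Complex.exp (φ * Complex.I)

section Ray

variable {φ c v : ℝ}

theorem rayPoint_re : (rayPoint φ c v).re = c + v * Real.cos φ := by
  simp [rayPoint, Complex.exp_ofReal_mul_I_re]

theorem rayPoint_im : (rayPoint φ c v).im = v * Real.sin φ := by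
  simp [rayPoint, Complex.exp_ofReal_mul_I_im]

theorem continuous_rayPoint : Continuous (rayPoint φ c) := by
  unfold rayPoint; fun_prop

theorem norm_rayPoint_le (hc : 0 ≤ c) (hv : 0 ≤ v) : ‖rayPoint φ c v‖ ≤ c + v := by
  refine (norm_add_le _ _).trans ?_
  simp [Complex.norm_exp_ofReal_mul_I, abs_of_nonneg, hc, hv]

theorem mul_sin_le_norm_rayPoint_right (hφ : 0 ≤ Real.sin φ) (hv : 0 ≤ v) :
    v * Real.sin φ ≤ ‖rayPoint φ c v‖ := by
  have := Complex.abs_im_le_norm (rayPoint φ c v)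
  rw [rayPoint_im, abs_of_nonneg (by positivity)] at this
  exact this

/-- The distance from the origin to the line carrying the ray is c |sin φ|; the difference of the
squares is (v + c cos φ)². -/
theorem mul_sin_le_norm_rayPoint_left :
    c * Real.sin φ ≤ ‖rayPoint φ c v‖ := by
  refine (le_abs_self _).trans (abs_le_of_sq_le_sq ?_ (norm_nonneg _))
  rw [Complex.sq_norm, Complex.normSq_apply, rayPoint_re, rayPoint_im]
  have := Real.sin_sq_add_cos_sq φ
  have e1 : v ^ 2 * (Real.sin φ ^ 2 + Real.cos φ ^ 2) = v ^ 2 := by rw [this, mul_one]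
  have e2 : c ^ 2 * (Real.sin φ ^ 2 + Real.cos φ ^ 2) = c ^ 2 := by rw [this, mul_one]
  linarith [sq_nonneg (v + c * Real.cos φ)]

theorem rayPoint_mem_slitPlane (hφ : 0 < Real.sin φ) (hc : 0 < c) (hv : 0 ≤ v) :
    rayPoint φ c v ∈ Complex.slitPlane := by
  rw [Complex.mem_slitPlane_iff, rayPoint_re, rayPoint_im]
  rcases hv.eq_or_lt with rfl | hv
  · left; simpa
  · right; positivity

/-- The point lies in the sector spanned by 1 and e^{iφ}. Arguments are compared through their
cosines, using that the norm is at least v - c and that cos φ lies in [-1, 0]. -/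
theorem arg_rayPoint_le (hφ : 0 < φ) (hφ' : φ < Real.pi) (hc : 0 ≤ c) (hv : 0 ≤ v)
    (hcos : Real.cos φ ≤ 0) (h0 : rayPoint φ c v ≠ 0) :
    0 ≤ (rayPoint φ c v).arg ∧ (rayPoint φ c v).arg ≤ φ := by
  have hs := Real.sin_pos_of_pos_of_lt_pi hφ hφ'
  have h1 : 0 ≤ (rayPoint φ c v).arg := by
    rw [Complex.arg_nonneg_iff, rayPoint_im]; positivity
  refine ⟨h1, ?_⟩
  rw [← Real.strictAntiOn_cos.le_iff_ge ⟨hφ.le, hφ'.le⟩ ⟨h1, Complex.arg_le_pi _⟩,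
    Complex.cos_arg h0, le_div_iff₀ (norm_pos_iff.2 h0), rayPoint_re]
  have h2 : v - c ≤ ‖rayPoint φ c v‖ := by
    have := norm_sub_norm_le ((v : ℂ) * Complex.exp (φ * Complex.I)) (-(c : ℂ))
    rw [norm_mul, Complex.norm_exp_ofReal_mul_I, norm_neg, sub_neg_eq_add, add_comm _ (c : ℂ)] at this
    simpa [rayPoint, abs_of_nonneg, hv, hc] using this
  nlinarith [Real.neg_one_le_cos φ]

/-- One summand serves negative exponents and the other nonnegative ones, so no case split on w is
needed later. -/
theorem norm_rayPoint_cpow_le (hφ : 0 < Real.sin φ) (hc : 0 < c) (hv : 0 ≤ v) (w : ℝ) :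
    ‖rayPoint φ c v ^ (w : ℂ)‖ ≤ (c * Real.sin φ) ^ w + (c + v) ^ w := by
  rw [Complex.norm_cpow_real]
  have h1 := mul_sin_le_norm_rayPoint_left (φ := φ) (c := c) (v := v)
  have h2 := norm_rayPoint_le (φ := φ) hc.le hv
  have hp : 0 < c * Real.sin φ := by positivity
  rcases le_total w 0 with hw | hw
  · have := Real.rpow_le_rpow_of_nonpos hp h1 hw
    have : 0 ≤ (c + v) ^ w := by positivity
    linarith
  · have := Real.rpow_le_rpow (norm_nonneg _) h2 hw
    have : 0 ≤ (c * Real.sin φ) ^ w := by positivity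
    linarith

theorem norm_cexp_mul_rayPoint (t : ℝ) :
    ‖Complex.exp (t * rayPoint φ c v)‖ = Real.exp (t * c) * Real.exp (t * Real.cos φ * v) := by
  rw [Complex.norm_exp, Complex.re_ofReal_mul, rayPoint_re, ← Real.exp_add]
  ring_nf

theorem hasDerivAt_rayPoint : HasDerivAt (rayPoint φ c) (Complex.exp (φ * Complex.I)) v := by
  unfold rayPoint
  have := ((Complex.ofRealCLM.hasDerivAt (x := v)).mul_const
    (Complex.exp (φ * Complex.I))).const_add (c : ℂ)
  simpa using this

theorem hasDerivAt_rayPoint_start : HasDerivAt (fun c => rayPoint φ c v) 1 c := by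
  unfold rayPoint
  have := (Complex.ofRealCLM.hasDerivAt (x := c)).add_const (v * Complex.exp (φ * Complex.I))
  simpa using this

end Ray

theorem integrableOn_add_rpow_mul_exp {c k : ℝ} (hc : 0 < c) (hk : 0 < k) (w : ℝ) :
    IntegrableOn (fun v : ℝ => (c + v) ^ w * Real.exp (-k * v)) (Ioi 0) := by
  refine integrable_of_isBigO_exp_neg (b := k / 2) (by linarith) ?_ ?_
  · refine ContinuousOn.mul ?_ (by fun_prop)
    exact ContinuousOn.rpow_const (by fun_prop) fun v hv => Or.inl (by
      have : (0 : ℝ) ≤ v := hv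
      positivity)
  · have h1 := (isLittleO_rpow_exp_pos_mul_atTop w (b := k / 2) (by linarith)).comp_tendsto
      (tendsto_atTop_add_const_left atTop c tendsto_id)
    have h2 := h1.isBigO.mul (Asymptotics.isBigO_refl (fun v : ℝ => Real.exp (-k * v)) atTop)
    refine h2.trans ?_
    refine Asymptotics.IsBigO.of_bound (Real.exp (k / 2 * c)) (Eventually.of_forall fun v => ?_)
    simp only [Function.comp, id]
    rw [← Real.exp_add, Real.norm_of_nonneg (Real.exp_pos _).le,
      Real.norm_of_nonneg (Real.exp_pos _).le, ← Real.exp_add]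
    apply Real.exp_le_exp.2
    linarith

/-! ### Hankel's formula on a ray -/

/-- The integrand of the Hankel integral of `exp (t s) s ^ (-z)` along a ray. -/
noncomputable def hankelIntegrand (φ c t z v : ℝ) : ℂ :=
  Complex.exp (φ * Complex.I) *
    (Complex.exp (t * rayPoint φ c v) * rayPoint φ c v ^ ((-z : ℝ) : ℂ))

/-- The Hankel integral of `exp (t s) s ^ (-z)` along the upper ray that starts at `c`. -/
noncomputable def hankelIntegral (φ c t z : ℝ) : ℂ :=
  ∫ v in Ioi (0 : ℝ), hankelIntegrand φ c t z v

section Hankel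

variable {φ c t z : ℝ}

theorem norm_hankelIntegrand (v : ℝ) : ‖hankelIntegrand φ c t z v‖ =
    Real.exp (t * c) * Real.exp (t * Real.cos φ * v) * ‖rayPoint φ c v ^ ((-z : ℝ) : ℂ)‖ := by
  rw [hankelIntegrand, norm_mul, Complex.norm_exp_ofReal_mul_I, norm_mul, norm_cexp_mul_rayPoint,
    one_mul]

theorem continuousOn_rayPoint_cpow (hφ : 0 < Real.sin φ) (hc : 0 < c) (w : ℂ) :
    ContinuousOn (fun v => rayPoint φ c v ^ w) (Ioi 0) :=
  continuous_rayPoint.continuousOn.cpow_const fun _ hv => rayPoint_mem_slitPlane hφ hc (le_of_lt hv)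

theorem continuousOn_hankelIntegrand (hφ : 0 < Real.sin φ) (hc : 0 < c) :
    ContinuousOn (hankelIntegrand φ c t z) (Ioi 0) := by
  unfold hankelIntegrand
  refine continuousOn_const.mul (ContinuousOn.mul ?_ (continuousOn_rayPoint_cpow hφ hc _))
  exact (Complex.continuous_exp.comp (continuous_const.mul continuous_rayPoint)).continuousOn

theorem aestronglyMeasurable_hankelIntegrand (hφ : 0 < Real.sin φ) (hc : 0 < c) :
    AEStronglyMeasurable (hankelIntegrand φ c t z) (volume.restrict (Ioi 0)) :=
  (continuousOn_hankelIntegrand hφ hc).aestronglyMeasurable measurableSet_Ioi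

theorem integrableOn_hankelIntegrand (hφ : 0 < Real.sin φ) (hφ' : Real.cos φ < 0) (hc : 0 < c)
    (ht : 0 < t) (z : ℝ) : IntegrableOn (hankelIntegrand φ c t z) (Ioi 0) := by
  have hk : 0 < -(t * Real.cos φ) := by nlinarith
  have h1 := integrableOn_add_rpow_mul_exp hc hk (-z)
  have h2 := integrableOn_rpow_mul_exp_neg (p := 0) (by norm_num) hk
  refine Integrable.mono' (((h2.const_mul ((c * Real.sin φ) ^ (-z))).add h1).const_mul
    (Real.exp (t * c))) (aestronglyMeasurable_hankelIntegrand hφ hc) ?_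
  filter_upwards [self_mem_ae_restrict measurableSet_Ioi] with v hv
  rw [norm_hankelIntegrand]
  have := norm_rayPoint_cpow_le hφ hc (le_of_lt hv) (-z)
  calc _ ≤ Real.exp (t * c) * Real.exp (t * Real.cos φ * v) *
        ((c * Real.sin φ) ^ (-z) + (c + v) ^ (-z)) := by gcongr
    _ = _ := by
      simp only [Pi.add_apply, Real.rpow_zero, neg_neg]
      ring

theorem hasDerivAt_cexp_mul_cpow {s : ℂ} (hs : s ∈ Complex.slitPlane) (t z : ℝ) :
    HasDerivAt (fun s : ℂ => Complex.exp (t * s) * s ^ ((-z : ℝ) : ℂ))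
      (t * (Complex.exp (t * s) * s ^ ((-z : ℝ) : ℂ)) -
        z * (Complex.exp (t * s) * s ^ ((-(z + 1) : ℝ) : ℂ))) s := by
  have h1 : HasDerivAt (fun s : ℂ => Complex.exp (t * s)) (Complex.exp (t * s) * (t * 1)) s :=
    ((hasDerivAt_id s).const_mul (t : ℂ)).cexp
  have h2 := (hasDerivAt_id s).cpow_const (c := ((-z : ℝ) : ℂ)) hs
  refine (h1.mul h2).congr_deriv ?_
  have e : ((-z : ℝ) : ℂ) - 1 = ((-(z + 1) : ℝ) : ℂ) := by push_cast; ring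
  simp only [id, e]
  push_cast
  ring

/-- Integration by parts along a ray. -/
theorem hankelIntegral_parts (hφ : 0 < Real.sin φ) (hφ' : Real.cos φ < 0) (hc : 0 < c)
    (ht : 0 < t) (z : ℝ) : t * hankelIntegral φ c t z - z * hankelIntegral φ c t (z + 1) =
      -((Real.exp (t * c) * c ^ (-z) : ℝ) : ℂ) := by
  have hd : ∀ v ∈ Ici (0 : ℝ), HasDerivAt
      (fun v : ℝ => Complex.exp (t * rayPoint φ c v) * rayPoint φ c v ^ ((-z : ℝ) : ℂ))
      (t * hankelIntegrand φ c t z v - z * hankelIntegrand φ c t (z + 1) v) v := by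
    intro v hv
    have := (hasDerivAt_cexp_mul_cpow (rayPoint_mem_slitPlane hφ hc hv) t z).comp v
      (hasDerivAt_rayPoint (φ := φ) (c := c) (v := v))
    refine this.congr_deriv ?_
    simp only [hankelIntegrand]
    ring
  have hi := integrableOn_hankelIntegrand hφ hφ' hc ht z
  have hi' := integrableOn_hankelIntegrand hφ hφ' hc ht (z + 1)
  have hlim : Tendsto
      (fun v : ℝ => Complex.exp (t * rayPoint φ c v) * rayPoint φ c v ^ ((-z : ℝ) : ℂ))
      atTop (𝓝 0) := by
    have hk : 0 < -(t * Real.cos φ) := by nlinarith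
    refine squeeze_zero_norm' (a := fun v => Real.exp (t * c) *
      (((c * Real.sin φ) ^ (-z) + (c + v) ^ (-z)) * Real.exp (t * Real.cos φ * v))) ?_ ?_
    · filter_upwards [eventually_ge_atTop 0] with v hv
      rw [norm_mul, norm_cexp_mul_rayPoint]
      have := norm_rayPoint_cpow_le hφ hc hv (-z)
      calc _ ≤ Real.exp (t * c) * Real.exp (t * Real.cos φ * v) *
            ((c * Real.sin φ) ^ (-z) + (c + v) ^ (-z)) := by gcongr
        _ = _ := by ring
    · have h1 : Tendsto (fun v => Real.exp (t * Real.cos φ * v)) atTop (𝓝 0) :=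
        Real.tendsto_exp_atBot.comp (tendsto_id.const_mul_atTop_of_neg (by linarith))
      have h2 := ((isLittleO_rpow_exp_pos_mul_atTop (-z) hk).tendsto_div_nhds_zero).comp
        (tendsto_atTop_add_const_left atTop c tendsto_id)
      have h3 := (((h1.const_mul ((c * Real.sin φ) ^ (-z))).add
        (h2.const_mul (Real.exp (-(t * Real.cos φ) * c)))).const_mul (Real.exp (t * c)))
      simp only [mul_zero, add_zero] at h3
      refine h3.congr fun v => ?_
      simp only [Function.comp, id]
      have e : Real.exp (-(t * Real.cos φ) * (c + v)) =
          Real.exp (-(t * Real.cos φ) * c) * (Real.exp (t * Real.cos φ * v))⁻¹ := by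
        rw [← Real.exp_neg, ← Real.exp_add]; ring_nf
      rw [e]
      field_simp
  have hcont := (hd 0 self_mem_Ici).continuousAt.continuousWithinAt (s := Ici 0)
  have := integral_Ioi_of_hasDerivAt_of_tendsto' hd ((hi.const_mul _).sub (hi'.const_mul _)) hlim
  rw [integral_sub (hi.const_mul _) (hi'.const_mul _), integral_const_mul, integral_const_mul] at this
  rw [hankelIntegral, hankelIntegral, this]
  have e0 : rayPoint φ c 0 = c := by simp [rayPoint]
  rw [e0, zero_sub]
  push_cast [Complex.ofReal_cpow hc.le]
  rfl

/-- The boundary term in `hankelIntegral_parts` is real, so the imaginary part obeys the same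
recurrence in z as h_z(t). -/
theorem hankelIntegral_im_add_one (hφ : 0 < Real.sin φ) (hφ' : Real.cos φ < 0) (hc : 0 < c)
    (ht : 0 < t) (z : ℝ) : z * (hankelIntegral φ c t (z + 1)).im = t * (hankelIntegral φ c t z).im := by
  have h := congrArg Complex.im (hankelIntegral_parts hφ hφ' hc ht z)
  rw [Complex.sub_im, Complex.im_ofReal_mul, Complex.im_ofReal_mul, Complex.neg_im,
    Complex.ofReal_im] at h
  linarith

/-- Up to the direction factor, varying c and varying v differentiate the same holomorphic function,
so the differentiated integral is again the one evaluated by parts. Its value is real, hence the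
imaginary part does not depend on c; this stands in for contour deformation. -/
theorem hasDerivAt_hankelIntegral (hφ : 0 < Real.sin φ) (hφ' : Real.cos φ < 0) (hc : 0 < c)
    (ht : 0 < t) (hz : 0 < z) : HasDerivAt (fun c => hankelIntegral φ c t z)
      (-((Real.exp (t * c) * c ^ (-z) : ℝ) : ℂ)) c := by
  have hk : 0 < -(t * Real.cos φ) := by nlinarith
  have hi := integrableOn_hankelIntegrand hφ hφ' hc ht z
  have hi' := integrableOn_hankelIntegrand hφ hφ' hc ht (z + 1)
  have hnhds : Ioo (c / 2) (2 * c) ∈ 𝓝 c := Ioo_mem_nhds (by linarith) (by linarith)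
  set m := c / 2 * Real.sin φ with hm
  have hm0 : 0 < m := by positivity
  have hb : ∀ w : ℝ, 0 < w → ∀ v ∈ Ioi (0 : ℝ), ∀ x ∈ Ioo (c / 2) (2 * c),
      ‖hankelIntegrand φ x t w v‖ ≤
        Real.exp (t * (2 * c)) * m ^ (-w) * Real.exp (t * Real.cos φ * v) := by
    intro w hw v hv x hx
    rw [norm_hankelIntegrand, Complex.norm_cpow_real]
    have h1 : m ≤ ‖rayPoint φ x v‖ := by
      refine le_trans ?_ (mul_sin_le_norm_rayPoint_left (φ := φ) (c := x) (v := v))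
      rw [hm]; gcongr; exact hx.1.le
    have h2 := Real.rpow_le_rpow_of_nonpos hm0 h1 (by linarith : -w ≤ 0)
    have h3 : Real.exp (t * x) ≤ Real.exp (t * (2 * c)) := by
      gcongr; exact hx.2.le
    calc _ ≤ Real.exp (t * (2 * c)) * Real.exp (t * Real.cos φ * v) * m ^ (-w) := by gcongr
      _ = _ := by ring
  have key := (hasDerivAt_integral_of_dominated_loc_of_deriv_le
    (μ := volume.restrict (Ioi (0 : ℝ))) (F := fun c v => hankelIntegrand φ c t z v)
    (F' := fun c v => t * hankelIntegrand φ c t z v - z * hankelIntegrand φ c t (z + 1) v)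
    (bound := fun v => (t * (Real.exp (t * (2 * c)) * m ^ (-z)) +
      z * (Real.exp (t * (2 * c)) * m ^ (-(z + 1)))) * Real.exp (t * Real.cos φ * v)) hnhds
    ?_ hi ((hi.const_mul _).sub (hi'.const_mul _)).aestronglyMeasurable ?_ ?_ ?_).2
  · rw [integral_sub (hi.const_mul _) (hi'.const_mul _), integral_const_mul,
      integral_const_mul] at key
    rw [← hankelIntegral_parts hφ hφ' hc ht z]
    exact key
  · filter_upwards [lt_mem_nhds hc] with x hx
    exact aestronglyMeasurable_hankelIntegrand hφ hx
  · filter_upwards [self_mem_ae_restrict measurableSet_Ioi] with v hv x hx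
    refine (norm_sub_le _ _).trans ?_
    rw [norm_mul, norm_mul, Complex.norm_real, Complex.norm_real, Real.norm_of_nonneg ht.le,
      Real.norm_of_nonneg hz.le]
    have h1 := hb z hz v hv x hx
    have h2 := hb (z + 1) (by linarith) v hv x hx
    calc _ ≤ t * (Real.exp (t * (2 * c)) * m ^ (-z) * Real.exp (t * Real.cos φ * v)) +
        z * (Real.exp (t * (2 * c)) * m ^ (-(z + 1)) * Real.exp (t * Real.cos φ * v)) := by gcongr
      _ = _ := by ring
  · have h2 := integrableOn_rpow_mul_exp_neg (p := 0) (by norm_num) hk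
    simp only [Real.rpow_zero, one_mul, neg_neg] at h2
    exact h2.const_mul _
  · filter_upwards [self_mem_ae_restrict measurableSet_Ioi] with v hv x hx
    have hx0 : 0 < x := by linarith [hx.1]
    have hs := rayPoint_mem_slitPlane hφ hx0 (le_of_lt hv)
    have := ((hasDerivAt_cexp_mul_cpow hs t z).comp x
      (hasDerivAt_rayPoint_start (φ := φ) (c := x) (v := v))).const_mul
      (Complex.exp (φ * Complex.I))
    refine this.congr_deriv ?_
    simp only [hankelIntegrand]
    ring

theorem hankelIntegral_im_const (hφ : 0 < Real.sin φ) (hφ' : Real.cos φ < 0)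
    (ht : 0 < t) (hz : 0 < z) {c c' : ℝ} (hc : 0 < c) (hc' : 0 < c') :
    (hankelIntegral φ c t z).im = (hankelIntegral φ c' t z).im := by
  have hd : ∀ x ∈ Ioi (0 : ℝ), HasDerivAt (fun c => (hankelIntegral φ c t z).im) 0 x := by
    intro x hx
    have := (hasDerivAt_hankelIntegral hφ hφ' hx ht hz)
    have h2 := Complex.imCLM.hasFDerivAt.comp_hasDerivAt x this
    refine h2.congr_deriv ?_
    rw [Complex.imCLM_apply, Complex.neg_im, Complex.ofReal_im, neg_zero]
  exact (convex_Ioi (0 : ℝ)).is_const_of_fderivWithin_eq_zero (𝕜 := ℝ)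
    (fun x hx => (hd x hx).differentiableAt.differentiableWithinAt)
    (fun x hx => by
      rw [fderivWithin_of_isOpen isOpen_Ioi hx]
      ext
      simpa using (hd x hx).deriv) hc hc'

theorem ofReal_mul_cexp_cpow {r θ : ℝ} (hr : 0 < r) (h1 : -Real.pi < θ) (h2 : θ ≤ Real.pi)
    (w : ℝ) : ((r : ℂ) * Complex.exp (θ * Complex.I)) ^ (w : ℂ) =
      ((r ^ w : ℝ) : ℂ) * Complex.exp ((θ * w : ℝ) * Complex.I) := by
  have e : (r : ℂ) * Complex.exp (θ * Complex.I) =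
      Complex.exp ((Real.log r : ℝ) + θ * Complex.I) := by
    rw [Complex.exp_add, ← Complex.ofReal_exp, Real.exp_log hr]
  rw [e, Complex.cpow_def_of_ne_zero (Complex.exp_ne_zero _), Complex.log_exp (by simpa)
    (by simpa), Real.rpow_def_of_pos hr, add_mul, Complex.exp_add]
  push_cast
  ring_nf

/-- The reflection formula in a form that also covers the poles of Γ, where `Real.Gamma` is 0, so
that the quotient is 0 and represents 1/Γ correctly. -/
theorem Gamma_one_sub_mul_sin {z : ℝ} (hz : z < 1) :
    Real.Gamma (1 - z) * Real.sin (Real.pi * z) = Real.pi / Real.Gamma z := by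
  have h := Real.Gamma_mul_Gamma_one_sub z
  have hG := (Real.Gamma_pos_of_pos (by linarith : 0 < 1 - z)).ne'
  by_cases hs : Real.sin (Real.pi * z) = 0
  · rw [hs, div_zero] at h
    rw [(mul_eq_zero.1 h).resolve_right hG, hs, mul_zero, div_zero]
  · have hz0 : Real.Gamma z ≠ 0 := by
      intro h0
      rw [h0, zero_mul, eq_comm, div_eq_zero_iff] at h
      exact h.elim Real.pi_ne_zero hs
    rw [eq_div_iff hs] at h
    rw [eq_div_iff hz0]
    linear_combination h

/-- With c = 0 the integral is a Gamma integral of rate -t e^{iφ} = t e^{i(φ-π)}. The phases combine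
to e^{i(π-πz)}, and reflection turns Γ(1-z) sin πz into π/Γ(z). -/
theorem hankelIntegral_zero_start_im (hφ : 0 < φ) (hφp : φ < Real.pi) (hφ' : Real.cos φ < 0)
    (ht : 0 < t) (hz : z < 1) :
    (∫ v in Ioi (0 : ℝ), hankelIntegrand φ 0 t z v).im = Real.pi * rlKernel z t := by
  have hre : 0 < (-(t * Complex.exp (φ * Complex.I))).re := by
    rw [Complex.neg_re, Complex.re_ofReal_mul, Complex.exp_ofReal_mul_I_re]
    nlinarith
  have h := integral_rpow_mul_cexp (a := 1 - z) (by linarith) hre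
  have e : ∀ v ∈ Ioi (0 : ℝ), hankelIntegrand φ 0 t z v =
      Complex.exp (φ * Complex.I) * Complex.exp ((φ * -z : ℝ) * Complex.I) *
      (((v ^ (1 - z - 1) : ℝ) : ℂ) * Complex.exp (-(-(t * Complex.exp (φ * Complex.I)) * v))) := by
    intro v hv
    have hv0 : 0 ≤ v := le_of_lt hv
    have e1 : rayPoint φ 0 v = v * Complex.exp (φ * Complex.I) := by simp [rayPoint]
    have e2 : (1 - z - 1) = -z := by ring
    rw [hankelIntegrand, e1, ofReal_mul_cexp_cpow hv (by linarith) hφp.le, e2]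
    have e3 : (t : ℂ) * (v * Complex.exp (φ * Complex.I)) =
      -(-(t * Complex.exp (φ * Complex.I)) * v) := by ring
    rw [e3]
    ring
  have e4 : -((t : ℂ) * Complex.exp (φ * Complex.I)) =
      (t : ℂ) * Complex.exp ((φ - Real.pi : ℝ) * Complex.I) := by
    push_cast
    rw [sub_mul, Complex.exp_sub, Complex.exp_pi_mul_I]
    ring
  have e5 : (-((1 - z : ℝ) : ℂ)) = ((z - 1 : ℝ) : ℂ) := by push_cast; ring
  have e6 : Complex.exp (φ * Complex.I) * Complex.exp ((φ * -z : ℝ) * Complex.I) *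
      (Real.Gamma (1 - z) * (((t ^ (z - 1) : ℝ) : ℂ) *
        Complex.exp (((φ - Real.pi) * (z - 1) : ℝ) * Complex.I))) =
      ((Real.Gamma (1 - z) * t ^ (z - 1) : ℝ) : ℂ) *
        Complex.exp ((Real.pi - Real.pi * z : ℝ) * Complex.I) := by
    have : ((Real.pi - Real.pi * z : ℝ) : ℂ) * Complex.I = φ * Complex.I +
        (φ * -z : ℝ) * Complex.I + ((φ - Real.pi) * (z - 1) : ℝ) * Complex.I := by
      push_cast; ring
    rw [this, Complex.exp_add, Complex.exp_add]
    push_cast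
    ring
  rw [setIntegral_congr_fun measurableSet_Ioi e, integral_const_mul, h, e4, e5,
    ofReal_mul_cexp_cpow ht (by linarith) (by linarith), e6, Complex.im_ofReal_mul,
    Complex.exp_ofReal_mul_I_im, Real.sin_pi_sub, rlKernel, mul_right_comm, Gamma_one_sub_mul_sin hz]
  ring

/-- Let c tend to 0 from the right; the imaginary part is constant in c. The bound |s| ≥ v sin φ
gives the majorant v^(-z), integrable at 0 because z < 1. -/
theorem hankelIntegral_im_of_lt_one (hφ : 0 < φ) (hφp : φ < Real.pi) (hφ' : Real.cos φ < 0)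
    (hc : 0 < c) (ht : 0 < t) (hz : 0 < z) (hz1 : z < 1) :
    (hankelIntegral φ c t z).im = Real.pi * rlKernel z t := by
  have hs := Real.sin_pos_of_pos_of_lt_pi hφ hφp
  have hk : 0 < -(t * Real.cos φ) := by nlinarith
  have hlim : Tendsto (fun c => hankelIntegral φ c t z) (𝓝[>] 0)
      (𝓝 (∫ v in Ioi (0 : ℝ), hankelIntegrand φ 0 t z v)) := by
    refine tendsto_integral_filter_of_dominated_convergence
      (fun v => Real.exp t * Real.sin φ ^ (-z) * (v ^ (-z) * Real.exp (-(-(t * Real.cos φ)) * v)))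
      ?_ ?_ ((integrableOn_rpow_mul_exp_neg (by linarith) hk).const_mul _) ?_
    · filter_upwards [self_mem_nhdsWithin] with x hx
      exact aestronglyMeasurable_hankelIntegrand hs hx
    · filter_upwards [Ioo_mem_nhdsGT (zero_lt_one (α := ℝ))] with x hx
      filter_upwards [self_mem_ae_restrict measurableSet_Ioi] with v hv
      have hv0 : 0 < v := hv
      rw [norm_hankelIntegrand, Complex.norm_cpow_real]
      have h1 := mul_sin_le_norm_rayPoint_right (φ := φ) (c := x) hs.le hv0.le
      have h2 := Real.rpow_le_rpow_of_nonpos (by positivity) h1 (by linarith : -z ≤ 0)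
      rw [Real.mul_rpow hv0.le hs.le] at h2
      have h3 : Real.exp (t * x) ≤ Real.exp t := by
        apply Real.exp_le_exp.2
        nlinarith [hx.2]
      calc _ ≤ Real.exp t * Real.exp (t * Real.cos φ * v) * (v ^ (-z) * Real.sin φ ^ (-z)) := by
            gcongr
        _ = _ := by rw [neg_neg]; ring
    · filter_upwards [self_mem_ae_restrict measurableSet_Ioi] with v hv
      have hv0 : 0 < v := hv
      have hcont : ContinuousAt (fun c => rayPoint φ c v) 0 :=
        hasDerivAt_rayPoint_start.continuousAt
      have hmem : rayPoint φ 0 v ∈ Complex.slitPlane := by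
        rw [Complex.mem_slitPlane_iff, rayPoint_im]
        right; positivity
      have hF : ContinuousAt (fun c => hankelIntegrand φ c t z v) 0 := by
        unfold hankelIntegrand
        exact continuousAt_const.mul ((continuousAt_const.mul hcont).cexp.mul
          (hcont.cpow continuousAt_const hmem))
      exact hF.tendsto.mono_left nhdsWithin_le_nhds
  have h1 := (Complex.continuous_im.tendsto _).comp hlim
  rw [hankelIntegral_zero_start_im hφ hφp hφ' ht hz1] at h1
  refine tendsto_nhds_unique (tendsto_const_nhds.congr' ?_) h1
  filter_upwards [self_mem_nhdsWithin] with x hx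
  exact hankelIntegral_im_const hs hφ' ht hz hc hx

/-- At z = 1 the integral from the origin is no longer absolutely convergent, so c stays fixed and z
tends to 1 from the left. -/
theorem hankelIntegral_im_one (hφ : 0 < φ) (hφp : φ < Real.pi) (hφ' : Real.cos φ < 0)
    (hc : 0 < c) (ht : 0 < t) : (hankelIntegral φ c t 1).im = Real.pi * rlKernel 1 t := by
  have hs := Real.sin_pos_of_pos_of_lt_pi hφ hφp
  have hk : 0 < -(t * Real.cos φ) := by nlinarith
  set m := c * Real.sin φ with hm
  have hm0 : 0 < m := by positivity
  have hlim : Tendsto (fun z => hankelIntegral φ c t z) (𝓝[<] 1) (𝓝 (hankelIntegral φ c t 1)) := by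
    refine tendsto_integral_filter_of_dominated_convergence
      (fun v => Real.exp (t * c) * (1 + m⁻¹) * (v ^ (0 : ℝ) * Real.exp (-(-(t * Real.cos φ)) * v)))
      (Eventually.of_forall fun x => aestronglyMeasurable_hankelIntegrand hs hc)
      ?_ ((integrableOn_rpow_mul_exp_neg (by linarith) hk).const_mul _) ?_
    · filter_upwards [Ioo_mem_nhdsLT (zero_lt_one (α := ℝ))] with x hx
      filter_upwards [self_mem_ae_restrict measurableSet_Ioi] with v hv
      rw [norm_hankelIntegrand, Complex.norm_cpow_real]
      have h1 := mul_sin_le_norm_rayPoint_left (φ := φ) (c := c) (v := v)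
      have h2 := Real.rpow_le_rpow_of_nonpos hm0 h1 (by linarith [hx.1] : -x ≤ 0)
      have h3 : m ^ (-x) ≤ 1 + m⁻¹ := by
        rw [Real.rpow_neg hm0.le, ← Real.inv_rpow hm0.le]
        have hmi : 0 < m⁻¹ := by positivity
        rcases le_total m⁻¹ 1 with h | h
        · have := Real.rpow_le_one hmi.le h hx.1.le
          linarith
        · have := Real.rpow_le_rpow_of_exponent_le h hx.2.le
          rw [Real.rpow_one] at this
          linarith
      calc _ ≤ Real.exp (t * c) * Real.exp (t * Real.cos φ * v) * (1 + m⁻¹) := by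
            gcongr; exact h2.trans h3
        _ = _ := by rw [neg_neg, Real.rpow_zero]; ring
    · filter_upwards [self_mem_ae_restrict measurableSet_Ioi] with v hv
      have h0 : rayPoint φ c v ≠ 0 :=
        Complex.slitPlane_ne_zero (rayPoint_mem_slitPlane hs hc (le_of_lt hv))
      have hF : ContinuousAt (fun z => hankelIntegrand φ c t z v) 1 := by
        unfold hankelIntegrand
        refine continuousAt_const.mul (continuousAt_const.mul ?_)
        exact (Complex.continuous_ofReal.comp continuous_neg).continuousAt.const_cpow (Or.inl h0)
      exact hF.tendsto.mono_left nhdsWithin_le_nhds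
  have h1 := (Complex.continuous_im.tendsto _).comp hlim
  have h2 : Tendsto (fun z => Real.pi * rlKernel z t) (𝓝[<] 1) (𝓝 (Real.pi * rlKernel 1 t)) :=
    ((hasDerivAt_rlKernel one_pos ht).continuousAt.tendsto.const_mul _).mono_left
      nhdsWithin_le_nhds
  refine tendsto_nhds_unique h1 (h2.congr' ?_)
  filter_upwards [Ioo_mem_nhdsLT (zero_lt_one (α := ℝ))] with x hx
  exact (hankelIntegral_im_of_lt_one hφ hφp hφ' hc ht hx.1 hx.2).symm

theorem rlKernel_add_one (ht : 0 < t) (z : ℝ) : z * rlKernel (z + 1) t = t * rlKernel z t := by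
  rcases eq_or_ne z 0 with rfl | hz
  · simp [rlKernel]
  · have e : t ^ z = t ^ (z - 1) * t := by
      rw [← Real.rpow_add_one ht.ne']; ring_nf
    rw [rlKernel, rlKernel, Real.Gamma_add_one hz, add_sub_cancel_right, e]
    field_simp

/-- Hankel's formula for the reciprocal of the Gamma function. -/
theorem hankelIntegral_im (hφ : 0 < φ) (hφp : φ < Real.pi) (hφ' : Real.cos φ < 0)
    (hc : 0 < c) (ht : 0 < t) (z : ℝ) :
    (hankelIntegral φ c t z).im = Real.pi * rlKernel z t := by
  have hs := Real.sin_pos_of_pos_of_lt_pi hφ hφp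
  have base : ∀ y : ℝ, 0 < y → y ≤ 1 → (hankelIntegral φ c t y).im = Real.pi * rlKernel y t := by
    intro y hy hy1
    rcases hy1.lt_or_eq with h | rfl
    · exact hankelIntegral_im_of_lt_one hφ hφp hφ' hc ht hy h
    · exact hankelIntegral_im_one hφ hφp hφ' hc ht
  -- Descending divides the recurrence by t only, so it passes through the nonpositive integers;
  -- ascending divides by y and is needed only for y > 0.
  have down : ∀ y : ℝ, (hankelIntegral φ c t (y + 1)).im = Real.pi * rlKernel (y + 1) t →
      (hankelIntegral φ c t y).im = Real.pi * rlKernel y t := by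
    intro y hy
    have h1 := hankelIntegral_im_add_one hs hφ' hc ht y
    rw [hy, mul_left_comm, rlKernel_add_one ht, mul_left_comm] at h1
    exact (mul_left_cancel₀ ht.ne' h1).symm
  have up : ∀ y : ℝ, 0 < y → (hankelIntegral φ c t y).im = Real.pi * rlKernel y t →
      (hankelIntegral φ c t (y + 1)).im = Real.pi * rlKernel (y + 1) t := by
    intro y hy0 hy
    have h1 := hankelIntegral_im_add_one hs hφ' hc ht y
    rw [hy, mul_left_comm, ← rlKernel_add_one ht, mul_left_comm] at h1
    exact mul_left_cancel₀ hy0.ne' h1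
  have all : ∀ n : ℕ, ∀ y : ℝ, -n < y → y ≤ n + 1 →
      (hankelIntegral φ c t y).im = Real.pi * rlKernel y t := by
    intro n
    induction n with
    | zero => intro y h1 h2; exact base y (by simpa using h1) (by simpa using h2)
    | succ n ih =>
      intro y h1 h2
      push_cast at h1 h2
      by_cases hlt : y ≤ -n
      · exact down y (ih (y + 1) (by linarith) (by linarith [(n.cast_nonneg : (0 : ℝ) ≤ n)]))
      · by_cases hgt : y ≤ n + 1
        · exact ih y (not_le.1 hlt) hgt
        · have hn : (0 : ℝ) ≤ n := n.cast_nonneg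
          have h3 := not_le.1 hgt
          have := up (y - 1) (by linarith) (ih (y - 1) (by linarith) (by linarith))
          rwa [sub_add_cancel] at this
  obtain ⟨n, hn⟩ := exists_nat_gt |z|
  have := abs_lt.1 hn
  exact all n z this.1 (by linarith [this.2])

end Hankel

/-! ### Power series of the Efros kernel -/

/-- Since α < 1, the term x (c+u)^α is eventually below k/2 (c+u), so half of the exponential decay
absorbs it. -/
theorem integrableOn_exp_neg_mul_add_rpow {α c k : ℝ} (hα : 0 < α) (hα1 : α < 1) (hk : 0 < k)
    (x : ℝ) : IntegrableOn (fun u : ℝ => Real.exp (-k * u) * Real.exp (x * (c + u) ^ α)) (Ioi 0) := by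
  refine integrable_of_isBigO_exp_neg (b := k / 2) (by linarith) ?_ ?_
  · refine ContinuousOn.mul (by fun_prop) (Real.continuous_exp.comp_continuousOn ?_)
    exact continuousOn_const.mul (ContinuousOn.rpow_const (by fun_prop) fun _ _ => Or.inr hα.le)
  · have h1 : Tendsto (fun u => |x| * (c + u) ^ (-(1 - α))) atTop (𝓝 (|x| * 0)) :=
      ((tendsto_rpow_neg_atTop (by linarith)).comp
        (tendsto_atTop_add_const_left atTop c tendsto_id)).const_mul _
    rw [mul_zero] at h1
    refine Asymptotics.IsBigO.of_bound (Real.exp (k / 2 * c)) ?_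
    filter_upwards [h1.eventually_le_const (by linarith : (0 : ℝ) < k / 2),
      eventually_gt_atTop (-c)] with u hu hu0
    have hpos : 0 < c + u := by linarith
    rw [← Real.exp_add, Real.norm_of_nonneg (Real.exp_pos _).le,
      Real.norm_of_nonneg (Real.exp_pos _).le, ← Real.exp_add]
    apply Real.exp_le_exp.2
    have e : (c + u) ^ α = (c + u) ^ (-(1 - α)) * (c + u) := by
      rw [← Real.rpow_add_one hpos.ne']; ring_nf
    have h2 : x * (c + u) ^ α ≤ k / 2 * (c + u) := by
      rw [e, ← mul_assoc]
      refine mul_le_mul_of_nonneg_right (le_trans ?_ hu) hpos.le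
      exact mul_le_mul_of_nonneg_right (le_abs_self x) (Real.rpow_nonneg hpos.le _)
    linarith

/-- Termwise integration of the exponential series. -/
theorem hasSum_integral_mul_cexp {μ : Measure ℝ} {g w : ℝ → ℂ} (hg : AEStronglyMeasurable g μ)
    (hw : AEStronglyMeasurable w μ) (x : ℝ)
    (hi : Integrable (fun v => ‖g v‖ * Real.exp (|x| * ‖w v‖)) μ) :
    HasSum (fun k : ℕ => ((((-x) ^ k / k.factorial : ℝ)) : ℂ) * ∫ v, g v * w v ^ k ∂μ)
      (∫ v, g v * Complex.exp (-(x * w v)) ∂μ) := by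
  have hexp : ∀ y : ℝ, HasSum (fun k : ℕ => y ^ k / (k.factorial : ℝ)) (Real.exp y) := fun y => by
    rw [Real.exp_eq_exp_ℝ]
    exact NormedSpace.expSeries_div_hasSum_exp y
  have hcexp : ∀ y : ℂ, HasSum (fun k : ℕ => y ^ k / (k.factorial : ℂ)) (Complex.exp y) :=
    fun y => by
      rw [Complex.exp_eq_exp_ℂ]
      exact NormedSpace.expSeries_div_hasSum_exp y
  have hb : ∀ v, HasSum (fun k : ℕ => ‖g v‖ * ((|x| * ‖w v‖) ^ k / (k.factorial : ℝ)))
      (‖g v‖ * Real.exp (|x| * ‖w v‖)) := fun v => (hexp _).mul_left _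
  have := hasSum_integral_of_dominated_convergence (μ := μ)
    (F := fun (k : ℕ) v => ((((-x) ^ k / k.factorial : ℝ)) : ℂ) * (g v * w v ^ k))
    (f := fun v => g v * Complex.exp (-(x * w v)))
    (fun k v => ‖g v‖ * ((|x| * ‖w v‖) ^ k / (k.factorial : ℝ)))
    (fun k => (hg.mul (hw.pow k)).const_mul _)
    (fun k => Eventually.of_forall fun v => ?_)
    (Eventually.of_forall fun v => (hb v).summable)
    (hi.congr (Eventually.of_forall fun v => (hb v).tsum_eq.symm))
    (Eventually.of_forall fun v => ?_)
  · simpa only [integral_const_mul] using this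
  · rw [norm_mul, norm_mul, norm_pow, Complex.norm_real, norm_div, norm_pow, norm_neg,
      Real.norm_eq_abs, Real.norm_of_nonneg (by positivity : (0 : ℝ) ≤ k.factorial), mul_pow]
    apply le_of_eq
    ring
  · refine ((hcexp (-(x * w v))).mul_left (g v)).congr_fun ?_ 
    intro k
    push_cast
    rw [← neg_mul, mul_pow]
    ring

/-- The integrand of the Bromwich–Hankel representation of the kernel `Φ_{α,0}`. -/
noncomputable def bromwichIntegrand (φ c α t x v : ℝ) : ℂ :=
  Complex.exp (φ * Complex.I) * Complex.exp (t * rayPoint φ c v) *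
    Complex.exp (-(x * rayPoint φ c v ^ (α : ℂ)))

/-- The right-hand side is e^{ts - x s^α} at s = u e^{-iπ}, the lower edge of the branch cut. -/
theorem efrosKernelIntegrand_zero_eq_im (α t x u : ℝ) :
    efrosKernelIntegrand α 0 t x u = (Complex.exp (-(t * u)) *
      Complex.exp (-(x * (((u ^ α : ℝ) : ℂ) * Complex.exp ((-(Real.pi * α) : ℝ) * Complex.I))))).im := by
  rw [← Complex.exp_add, Complex.exp_im, efrosKernelIntegrand]
  have e1 : (-((t : ℂ) * u) + -(x * (((u ^ α : ℝ) : ℂ) *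
      Complex.exp ((-(Real.pi * α) : ℝ) * Complex.I)))).re =
      -(u * t + x * u ^ α * Real.cos (Real.pi * α)) := by
    rw [Complex.add_re, Complex.neg_re, Complex.neg_re, ← mul_assoc, ← Complex.ofReal_mul,
      ← Complex.ofReal_mul, Complex.re_ofReal_mul, Complex.exp_ofReal_mul_I_re, Real.cos_neg,
      Complex.ofReal_re]
    ring
  have e2 : (-((t : ℂ) * u) + -(x * (((u ^ α : ℝ) : ℂ) *
      Complex.exp ((-(Real.pi * α) : ℝ) * Complex.I)))).im =
      x * u ^ α * Real.sin (Real.pi * α) := by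
    rw [Complex.add_im, Complex.neg_im, Complex.neg_im, ← mul_assoc, ← Complex.ofReal_mul,
      ← Complex.ofReal_mul, Complex.im_ofReal_mul, Complex.exp_ofReal_mul_I_im, Real.sin_neg,
      Complex.ofReal_im]
    ring
  rw [e1, e2, Real.rpow_zero, one_mul, mul_zero, add_zero, Real.exp_neg]
  ring

section Kernel

variable {φ c α t : ℝ}

theorem integrable_efros_bound (hα : 0 < α) (hα1 : α < 1) (ht : 0 < t) (x : ℝ) :
    Integrable (fun u : ℝ => ‖Complex.exp (-((t : ℂ) * u))‖ * Real.exp (|x| *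
      ‖((u ^ α : ℝ) : ℂ) * Complex.exp ((-(Real.pi * α) : ℝ) * Complex.I)‖))
      (volume.restrict (Ioi 0)) := by
  refine (integrableOn_exp_neg_mul_add_rpow (c := 0) hα hα1 ht |x|).congr_fun ?_ measurableSet_Ioi
  intro u hu
  simp only [zero_add]
  rw [norm_cexp_neg_mul_ofReal, norm_mul, Complex.norm_exp_ofReal_mul_I, Complex.norm_real,
    Real.norm_of_nonneg (Real.rpow_nonneg (le_of_lt hu) _), mul_one, Complex.ofReal_re]

theorem integrable_efros_complex (hα : 0 < α) (hα1 : α < 1) (ht : 0 < t) (x : ℝ) :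
    Integrable (fun u : ℝ => Complex.exp (-((t : ℂ) * u)) * Complex.exp (-(x *
      (((u ^ α : ℝ) : ℂ) * Complex.exp ((-(Real.pi * α) : ℝ) * Complex.I)))))
      (volume.restrict (Ioi 0)) := by
  refine (integrable_efros_bound hα hα1 ht x).mono' (by fun_prop) (Eventually.of_forall fun u => ?_)
  rw [norm_mul]
  refine mul_le_mul_of_nonneg_left ((Complex.norm_exp_le_exp_norm _).trans ?_) (norm_nonneg _)
  rw [norm_neg, norm_mul, Complex.norm_real, Real.norm_eq_abs]

theorem integrableOn_efrosKernelIntegrand (hα : 0 < α) (hα1 : α < 1) (ht : 0 < t) (x : ℝ) :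
    IntegrableOn (efrosKernelIntegrand α 0 t x) (Ioi 0) := by
  have h := (integrable_efros_complex hα hα1 ht x).im
  rw [funext (efrosKernelIntegrand_zero_eq_im α t x)]
  exact h

/-- Expanding e^{-x s^α} termwise gives Gamma integrals Γ(αk+1) t^(-αk-1) with phases e^{-iπαk};
reflection turns their imaginary parts into π h_{-αk}(t). -/
theorem hasSum_efrosKernel (hα : 0 < α) (hα1 : α < 1) (ht : 0 < t) (x : ℝ) :
    HasSum (fun k : ℕ => (-x) ^ k / k.factorial * (Real.pi * rlKernel (-(α * k)) t))
      (Real.pi * efrosKernel α 0 t x) := by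
  have h := hasSum_integral_mul_cexp (μ := volume.restrict (Ioi (0 : ℝ)))
    (g := fun u => Complex.exp (-((t : ℂ) * u)))
    (w := fun u => ((u ^ α : ℝ) : ℂ) * Complex.exp ((-(Real.pi * α) : ℝ) * Complex.I))
    (by fun_prop) (by fun_prop) x (integrable_efros_bound hα hα1 ht x)
  have h2 := Complex.imCLM.hasSum h
  have e : Real.pi * efrosKernel α 0 t x = (∫ u in Ioi (0 : ℝ), Complex.exp (-((t : ℂ) * u)) *
      Complex.exp (-(x * (((u ^ α : ℝ) : ℂ) *
        Complex.exp ((-(Real.pi * α) : ℝ) * Complex.I))))).im := by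
    have h3 := integral_im (integrable_efros_complex hα hα1 ht x)
    simp only [RCLike.im_to_complex, ← efrosKernelIntegrand_zero_eq_im] at h3
    rw [← h3, efrosKernel, if_neg (by norm_num), add_zero, mul_inv_cancel_left₀ Real.pi_ne_zero]
  rw [e]
  refine h2.congr_fun ?_
  intro k
  have hk : 0 < α * k + 1 := by positivity
  have h4 := integral_rpow_mul_cexp hk (r := (t : ℂ)) (by simpa using ht)
  have e2 : ∀ u ∈ Ioi (0 : ℝ), Complex.exp (-((t : ℂ) * u)) *
      (((u ^ α : ℝ) : ℂ) * Complex.exp ((-(Real.pi * α) : ℝ) * Complex.I)) ^ k =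
      Complex.exp ((-(Real.pi * α * k) : ℝ) * Complex.I) *
        (((u ^ (α * k + 1 - 1) : ℝ) : ℂ) * Complex.exp (-((t : ℂ) * u))) := by
    intro u hu
    rw [mul_pow, ← Complex.exp_nat_mul, add_sub_cancel_right, Real.rpow_mul (le_of_lt hu),
      Real.rpow_natCast]
    have : (k : ℂ) * ((-(Real.pi * α) : ℝ) * Complex.I) =
      (-(Real.pi * α * k) : ℝ) * Complex.I := by push_cast; ring
    rw [this]
    push_cast
    ring
  have h5 := Gamma_one_sub_mul_sin (z := -(α * k)) (by
    have : 0 ≤ α * k := by positivity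
    linarith)
  have e3 : 1 - -(α * k) = α * k + 1 := by ring
  have e4 : (-((α * k + 1 : ℝ) : ℂ)) = ((-(α * k) - 1 : ℝ) : ℂ) := by push_cast; ring
  rw [Complex.imCLM_apply, Complex.im_ofReal_mul, setIntegral_congr_fun measurableSet_Ioi e2,
    integral_const_mul, h4, e4, ← Complex.ofReal_cpow ht.le, ← Complex.ofReal_mul,
    mul_comm (Complex.exp _), Complex.im_ofReal_mul, Complex.exp_ofReal_mul_I_im, rlKernel]
  rw [e3, mul_neg, ← mul_assoc] at h5
  rw [mul_right_comm, h5]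
  ring

end Kernel

/-! ### Bromwich representation and moments of the kernel -/

/-- Admissible data of a ray: its angle `φ` is obtuse, and `α φ` is acute. -/
structure AdmissibleAngle (α φ : ℝ) : Prop where
  pos : 0 < φ
  lt_pi : φ < Real.pi
  cos_neg : Real.cos φ < 0
  cos_mul_pos : 0 < Real.cos (α * φ)
  mul_lt : α * φ < Real.pi / 2

theorem exists_admissibleAngle {α : ℝ} (hα : 0 < α) (hα1 : α < 1) : ∃ φ, AdmissibleAngle α φ := by
  have hπ := Real.pi_pos
  have h1 : Real.pi / 2 < min Real.pi (Real.pi / 2 / α) := by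
    rw [lt_min_iff, lt_div_iff₀ hα]
    constructor <;> nlinarith
  obtain ⟨φ, h2, h3⟩ := exists_between h1
  rw [lt_min_iff, lt_div_iff₀ hα, mul_comm] at h3
  have h0 : 0 < α * φ := by apply mul_pos hα; linarith
  exact ⟨φ, by linarith, h3.1, Real.cos_neg_of_pi_div_two_lt_of_lt h2 (by linarith [h3.1]),
    Real.cos_pos_of_mem_Ioo ⟨by linarith, h3.2⟩, h3.2⟩

section Kernel

variable {φ c α t : ℝ}

theorem AdmissibleAngle.sin_pos (h : AdmissibleAngle α φ) : 0 < Real.sin φ :=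
  Real.sin_pos_of_pos_of_lt_pi h.pos h.lt_pi

/-- A lower bound for the real part of `s ^ α` on a ray. -/
noncomputable def rayDecay (φ c α : ℝ) : ℝ := (c * Real.sin φ) ^ α * Real.cos (α * φ)

theorem AdmissibleAngle.rayDecay_pos (h : AdmissibleAngle α φ) (hc : 0 < c) :
    0 < rayDecay φ c α :=
  mul_pos (Real.rpow_pos_of_pos (mul_pos hc h.sin_pos) _) h.cos_mul_pos

/-- The starting point c is free, so any prescribed decay rate in x can be obtained by moving the
ray. -/
theorem AdmissibleAngle.exists_rayDecay_eq (h : AdmissibleAngle α φ) (hα : 0 < α) {κ : ℝ}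
    (hκ : 0 < κ) : ∃ c, 0 < c ∧ rayDecay φ c α = κ := by
  have h1 := h.sin_pos
  have h2 := h.cos_mul_pos
  refine ⟨(κ / Real.cos (α * φ)) ^ α⁻¹ / Real.sin φ, by positivity, ?_⟩
  rw [rayDecay, div_mul_cancel₀ _ h1.ne', Real.rpow_inv_rpow (by positivity) hα.ne',
    div_mul_cancel₀ _ h2.ne']

/-- On the ray |s| ≥ c sin φ, and the argument of s^α stays in [0, αφ] with αφ acute. -/
theorem AdmissibleAngle.rayDecay_le_re (h : AdmissibleAngle α φ) (hα : 0 < α) (hc : 0 < c) {v : ℝ}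
    (hv : 0 ≤ v) : rayDecay φ c α ≤ (rayPoint φ c v ^ (α : ℂ)).re := by
  have hs := h.sin_pos
  have h0 := Complex.slitPlane_ne_zero (rayPoint_mem_slitPlane hs hc hv)
  obtain ⟨h1, h2⟩ := arg_rayPoint_le h.pos h.lt_pi hc.le hv h.cos_neg.le h0
  rw [Complex.cpow_ofReal_re, rayDecay]
  have h3 : Real.cos (α * φ) ≤ Real.cos ((rayPoint φ c v).arg * α) := by
    have := h.mul_lt
    have := h.lt_pi
    have := Real.pi_pos
    apply Real.cos_le_cos_of_nonneg_of_le_pi (by positivity) (by linarith)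
    rw [mul_comm]; gcongr
  have h4 := Real.rpow_le_rpow (by positivity)
    (mul_sin_le_norm_rayPoint_left (φ := φ) (c := c) (v := v)) hα.le
  have := h.cos_mul_pos
  gcongr

theorem AdmissibleAngle.norm_bromwichIntegrand_le (h : AdmissibleAngle α φ) (hα : 0 < α)
    (hc : 0 < c) {v x : ℝ} (hv : 0 ≤ v) (hx : 0 ≤ x) : ‖bromwichIntegrand φ c α t x v‖ ≤
      Real.exp (t * c) * Real.exp (t * Real.cos φ * v) * Real.exp (-rayDecay φ c α * x) := by
  rw [bromwichIntegrand, norm_mul, norm_mul, Complex.norm_exp_ofReal_mul_I, one_mul,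
    norm_cexp_mul_rayPoint]
  refine mul_le_mul_of_nonneg_left ?_ (by positivity)
  rw [Complex.norm_exp, Complex.neg_re, Complex.re_ofReal_mul]
  apply Real.exp_le_exp.2
  have := h.rayDecay_le_re hα hc hv
  nlinarith

theorem integrableOn_exp_cos (h : AdmissibleAngle α φ) (ht : 0 < t) :
    IntegrableOn (fun v => Real.exp (t * Real.cos φ * v)) (Ioi 0) := by
  have := h.cos_neg
  have h2 := integrableOn_rpow_mul_exp_neg (p := 0) (k := -(t * Real.cos φ)) (by norm_num)
    (by nlinarith)
  simpa using h2

theorem aestronglyMeasurable_bromwichIntegrand (h : AdmissibleAngle α φ) (hc : 0 < c) :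
    AEStronglyMeasurable (fun p : ℝ × ℝ => bromwichIntegrand φ c α t p.2 p.1)
      ((volume.restrict (Ioi (0 : ℝ))).prod (volume.restrict (Ioi (0 : ℝ)))) := by
  have h1 : AEStronglyMeasurable (fun p : ℝ × ℝ => rayPoint φ c p.1 ^ (α : ℂ))
      ((volume.restrict (Ioi (0 : ℝ))).prod (volume.restrict (Ioi (0 : ℝ)))) :=
    ((continuousOn_rayPoint_cpow h.sin_pos hc (α : ℂ)).aestronglyMeasurable
      measurableSet_Ioi).comp_fst
  have h2 : Continuous fun p : ℝ × ℝ => rayPoint φ c p.1 := continuous_rayPoint.comp continuous_fst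
  unfold bromwichIntegrand
  refine AEStronglyMeasurable.mul (Continuous.aestronglyMeasurable (by fun_prop)) ?_
  refine Complex.continuous_exp.comp_aestronglyMeasurable (AEStronglyMeasurable.neg ?_)
  exact AEStronglyMeasurable.mul (Continuous.aestronglyMeasurable (by fun_prop)) h1

/-- The Bromwich–Hankel representation of the kernel `Φ_{α,0}`. -/
theorem efrosKernel_eq_bromwich (h : AdmissibleAngle α φ) (hα : 0 < α) (hα1 : α < 1) (hc : 0 < c)
    (ht : 0 < t) (x : ℝ) : Real.pi * efrosKernel α 0 t x =
      (∫ v in Ioi (0 : ℝ), bromwichIntegrand φ c α t x v).im := by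
  have hk : 0 < -(t * Real.cos φ) := by have := h.cos_neg; nlinarith
  have hr : Continuous (rayPoint φ c) := continuous_rayPoint
  have hw := (continuousOn_rayPoint_cpow h.sin_pos hc (α : ℂ)).aestronglyMeasurable
      (μ := volume) measurableSet_Ioi
  have h1 := hasSum_integral_mul_cexp (μ := volume.restrict (Ioi (0 : ℝ)))
    (g := fun v => Complex.exp (φ * Complex.I) * Complex.exp (t * rayPoint φ c v))
    (w := fun v => rayPoint φ c v ^ (α : ℂ))
    (Continuous.aestronglyMeasurable (by fun_prop)) hw x ?_
  · have h2 := Complex.imCLM.hasSum h1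
    -- Both sides have the same power series in x: by Hankel's formula the k-th ray integral has
    -- imaginary part π h_{-αk}(t).
    refine (hasSum_efrosKernel hα hα1 ht x).unique (h2.congr_fun fun k => ?_)
    rw [Complex.imCLM_apply, Complex.im_ofReal_mul,
      ← hankelIntegral_im h.pos h.lt_pi h.cos_neg hc ht]
    congr 2
    refine setIntegral_congr_fun measurableSet_Ioi fun v _ => ?_
    simp only [hankelIntegrand]
    have e : ((-(-(α * k)) : ℝ) : ℂ) = (k : ℂ) * α := by push_cast; ring
    rw [e, Complex.cpow_nat_mul, mul_assoc]
  · refine Integrable.mono' ((integrableOn_exp_neg_mul_add_rpow (c := c) hα hα1 hk |x|).const_mul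
      (Real.exp (t * c))) ?_ ?_
    · refine (Continuous.aestronglyMeasurable (by fun_prop)).mul ?_
      exact Real.continuous_exp.comp_aestronglyMeasurable (hw.norm.const_mul _)
    · filter_upwards [self_mem_ae_restrict measurableSet_Ioi] with v hv
      rw [Real.norm_of_nonneg (by positivity), norm_mul, Complex.norm_exp_ofReal_mul_I, one_mul,
        norm_cexp_mul_rayPoint, Complex.norm_cpow_real, neg_neg, mul_assoc]
      have := norm_rayPoint_le (φ := φ) hc.le (le_of_lt hv)
      gcongr

/-- The kernel `Φ_{α,0}(t, x)` decays in `x` faster than every exponential. -/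
theorem abs_efrosKernel_le (hα : 0 < α) (hα1 : α < 1) (ht : 0 < t) {κ : ℝ} (hκ : 0 < κ) :
    ∃ C, 0 ≤ C ∧ ∀ x, 0 ≤ x → |efrosKernel α 0 t x| ≤ C * Real.exp (-κ * x) := by
  obtain ⟨φ, h⟩ := exists_admissibleAngle hα hα1
  obtain ⟨c, hc, rfl⟩ := h.exists_rayDecay_eq hα hκ
  refine ⟨Real.pi⁻¹ * (Real.exp (t * c) * ∫ v in Ioi (0 : ℝ), Real.exp (t * Real.cos φ * v)),
    mul_nonneg (by positivity) (mul_nonneg (by positivity)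
      (integral_nonneg fun v => (Real.exp_pos _).le)), fun x hx => ?_⟩
  have h1 := efrosKernel_eq_bromwich h hα hα1 hc ht x
  have h2 : efrosKernel α 0 t x =
      Real.pi⁻¹ * (∫ v in Ioi (0 : ℝ), bromwichIntegrand φ c α t x v).im := by
    rw [← h1, inv_mul_cancel_left₀ Real.pi_ne_zero]
  rw [h2, abs_mul, abs_of_pos (inv_pos.2 Real.pi_pos), mul_assoc]
  refine mul_le_mul_of_nonneg_left ((Complex.abs_im_le_norm _).trans ?_)
    (inv_pos.2 Real.pi_pos).le
  have h3 := norm_integral_le_of_norm_le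
    (((integrableOn_exp_cos h ht).const_mul (Real.exp (t * c))).mul_const
      (Real.exp (-rayDecay φ c α * x)))
    (f := bromwichIntegrand φ c α t x) (by
      filter_upwards [self_mem_ae_restrict measurableSet_Ioi] with v hv
      exact h.norm_bromwichIntegrand_le hα hc (le_of_lt hv) hx)
  rwa [integral_mul_const, integral_const_mul] at h3

/-- Integration of a function against the kernel `Φ_{α,0}`, in terms of its Laplace transform. -/
theorem integral_efrosKernel_mul (h : AdmissibleAngle α φ) (hα : 0 < α) (hα1 : α < 1) (hc : 0 < c)
    (ht : 0 < t) {f : ℝ → ℝ}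
    (hf : IntegrableOn (fun x => Real.exp (-rayDecay φ c α * x) * f x) (Ioi 0)) :
    IntegrableOn (fun x => efrosKernel α 0 t x * f x) (Ioi 0) ∧
    Real.pi * ∫ x in Ioi (0 : ℝ), efrosKernel α 0 t x * f x =
      (∫ v in Ioi (0 : ℝ), ∫ x in Ioi (0 : ℝ), bromwichIntegrand φ c α t x v * (f x : ℂ)).im := by
  have hfm : AEStronglyMeasurable f (volume.restrict (Ioi (0 : ℝ))) := by
    have h1 : AEStronglyMeasurable (fun x => Real.exp (rayDecay φ c α * x) *
        (Real.exp (-rayDecay φ c α * x) * f x)) (volume.restrict (Ioi (0 : ℝ))) :=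
      (Continuous.aestronglyMeasurable (by fun_prop)).mul hf.aestronglyMeasurable
    refine h1.congr (Eventually.of_forall fun x => ?_)
    simp only
    rw [← mul_assoc, ← Real.exp_add]
    simp
  -- Absolute integrability for Fubini: the integrand is dominated by a product of a function of v
  -- and a function of x.
  have hK : Integrable (fun p : ℝ × ℝ => bromwichIntegrand φ c α t p.2 p.1 * (f p.2 : ℂ))
      ((volume.restrict (Ioi (0 : ℝ))).prod (volume.restrict (Ioi (0 : ℝ)))) := by
    refine Integrable.mono' (((integrableOn_exp_cos h ht).const_mul (Real.exp (t * c))).mul_prod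
      hf.norm) ((aestronglyMeasurable_bromwichIntegrand h hc).mul
        (Complex.continuous_ofReal.comp_aestronglyMeasurable hfm.comp_snd)) ?_
    rw [Measure.prod_restrict]
    filter_upwards [ae_restrict_mem (measurableSet_Ioi.prod measurableSet_Ioi)] with p hp
    have h1 := h.norm_bromwichIntegrand_le (t := t) hα hc (le_of_lt hp.1) (le_of_lt hp.2)
    rw [norm_mul, norm_mul, Complex.norm_real, Real.norm_of_nonneg (Real.exp_pos _).le, ← mul_assoc]
    gcongr
  have e : ∀ x, efrosKernel α 0 t x * f x =
      Real.pi⁻¹ * (∫ v in Ioi (0 : ℝ), bromwichIntegrand φ c α t x v * (f x : ℂ)).im := by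
    intro x
    rw [integral_mul_const, Complex.im_mul_ofReal, ← efrosKernel_eq_bromwich h hα hα1 hc ht,
      mul_assoc, inv_mul_cancel_left₀ Real.pi_ne_zero]
  have hI := hK.integral_prod_right
  simp only at hI
  constructor
  · simp only [e]
    exact hI.im.const_mul _
  · simp only [e]
    rw [integral_const_mul, mul_inv_cancel_left₀ Real.pi_ne_zero,
      integral_integral_swap (f := fun v x => bromwichIntegrand φ c α t x v * (f x : ℂ)) hK]
    exact integral_im hI

/-- After Fubini the inner integral is Γ(p+1) s^(-α(p+1)), and Hankel's formula evaluates the outer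
one. Real exponents p are allowed so that the identity can be differentiated in p. -/
theorem integral_efrosKernel_mul_rpow (hα : 0 < α) (hα1 : α < 1) (ht : 0 < t) {p : ℝ}
    (hp : -1 < p) : IntegrableOn (fun x => efrosKernel α 0 t x * x ^ p) (Ioi 0) ∧
    ∫ x in Ioi (0 : ℝ), efrosKernel α 0 t x * x ^ p =
      Real.Gamma (p + 1) * rlKernel (α * (p + 1)) t := by
  obtain ⟨φ, h⟩ := exists_admissibleAngle hα hα1
  have hs := h.sin_pos
  have hf : IntegrableOn (fun x : ℝ => Real.exp (-rayDecay φ 1 α * x) * x ^ p) (Ioi 0) := by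
    refine (integrableOn_rpow_mul_exp_neg hp (h.rayDecay_pos one_pos)).congr_fun
      (fun x _ => mul_comm _ _) measurableSet_Ioi
  obtain ⟨h1, h2⟩ := integral_efrosKernel_mul h hα hα1 one_pos ht hf
  refine ⟨h1, ?_⟩
  have e : ∀ v ∈ Ioi (0 : ℝ), ∫ x in Ioi (0 : ℝ), bromwichIntegrand φ 1 α t x v * ((x ^ p : ℝ) : ℂ) =
      Real.Gamma (p + 1) * hankelIntegrand φ 1 t (α * (p + 1)) v := by
    intro v hv
    have hre : 0 < (rayPoint φ 1 v ^ (α : ℂ)).re :=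
      (h.rayDecay_pos one_pos).trans_le (h.rayDecay_le_re hα one_pos (le_of_lt hv))
    have h3 := integral_rpow_mul_cexp (a := p + 1) (by linarith) hre
    have h0 := Complex.slitPlane_ne_zero (rayPoint_mem_slitPlane hs one_pos (le_of_lt hv))
    obtain ⟨ha1, ha2⟩ := arg_rayPoint_le h.pos h.lt_pi zero_le_one (le_of_lt hv) h.cos_neg.le h0
    have e1 : ∀ x : ℝ, bromwichIntegrand φ 1 α t x v * ((x ^ p : ℝ) : ℂ) =
        (Complex.exp (φ * Complex.I) * Complex.exp (t * rayPoint φ 1 v)) *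
        (((x ^ (p + 1 - 1) : ℝ) : ℂ) * Complex.exp (-(rayPoint φ 1 v ^ (α : ℂ) * x))) := by
      intro x
      rw [bromwichIntegrand, add_sub_cancel_right, mul_comm (x : ℂ)]
      ring
    have him : (Complex.log (rayPoint φ 1 v) * (α : ℂ)).im = (rayPoint φ 1 v).arg * α := by
      rw [Complex.im_mul_ofReal, Complex.log_im]
    have hb : (rayPoint φ 1 v).arg * α ≤ Real.pi := by
      have := h.mul_lt
      have := Real.pi_pos
      nlinarith
    -- The rule (s^α)^w = s^(αw) holds on the principal branch because α arg s stays in (-π, π].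
    have e2 : (rayPoint φ 1 v ^ (α : ℂ)) ^ (-((p + 1 : ℝ) : ℂ)) =
        rayPoint φ 1 v ^ ((-(α * (p + 1)) : ℝ) : ℂ) := by
      rw [← Complex.cpow_mul _ (by rw [him]; have := Real.pi_pos; nlinarith) (by rw [him]; exact hb)]
      congr 1
      push_cast
      ring
    simp only [e1]
    rw [integral_const_mul, h3, e2, hankelIntegrand]
    ring
  rw [setIntegral_congr_fun measurableSet_Ioi e, integral_const_mul, Complex.im_ofReal_mul] at h2
  have h4 := hankelIntegral_im h.pos h.lt_pi h.cos_neg one_pos ht (α * (p + 1))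
  rw [hankelIntegral] at h4
  rw [h4, mul_left_comm] at h2
  exact mul_left_cancel₀ Real.pi_ne_zero h2

end Kernel

/-! ### Logarithmic moments and the inner integral -/

/-- The coefficient functions of the power series in `λ` of the integral of
`exp (λ x) (log x + γ₀)` against the kernel `Φ_{α,0}`. -/
noncomputable def efrosTerm (α : ℝ) (n : ℕ) (t : ℝ) : ℝ :=
  harmonic n * rlKernel (α * (n + 1)) t + α * rlKernelDeriv (α * (n + 1)) t

section LogMoment

variable {α t : ℝ}

theorem integrableOn_efrosKernel (hα : 0 < α) (hα1 : α < 1) (ht : 0 < t) :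
    IntegrableOn (efrosKernel α 0 t) (Ioi 0) := by
  have := (integral_efrosKernel_mul_rpow hα hα1 ht (p := 0) (by norm_num)).1
  simpa using this

theorem integrableOn_efrosKernel_mul (hα : 0 < α) (hα1 : α < 1) (ht : 0 < t) {κ : ℝ} (hκ : 0 < κ)
    {f : ℝ → ℝ} (hf : IntegrableOn (fun x => Real.exp (-κ * x) * f x) (Ioi 0)) :
    IntegrableOn (fun x => efrosKernel α 0 t x * f x) (Ioi 0) := by
  obtain ⟨φ, h⟩ := exists_admissibleAngle hα hα1
  obtain ⟨c, hc, rfl⟩ := h.exists_rayDecay_eq hα hκ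
  exact (integral_efrosKernel_mul h hα hα1 hc ht hf).1

theorem integral_efrosKernel_mul_pow (hα : 0 < α) (hα1 : α < 1) (ht : 0 < t) (n : ℕ) :
    IntegrableOn (fun x => efrosKernel α 0 t x * x ^ n) (Ioi 0) ∧
    ∫ x in Ioi (0 : ℝ), efrosKernel α 0 t x * x ^ n =
      n.factorial * rlKernel (α * (n + 1)) t := by
  have h := integral_efrosKernel_mul_rpow hα hα1 ht (p := n)
    (by have : (0 : ℝ) ≤ n := n.cast_nonneg
        linarith)
  simpa only [Real.rpow_natCast, Real.Gamma_nat_eq_factorial] using h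

/-- Differentiate the Mellin transform s ↦ Γ(s) h_{αs}(t) of the kernel at s = n + 1. -/
theorem integral_efrosKernel_mul_pow_mul_log (hα : 0 < α) (hα1 : α < 1) (ht : 0 < t) (n : ℕ) :
    IntegrableOn (fun x => efrosKernel α 0 t x * (x ^ n * Real.log x)) (Ioi 0) ∧
    ∫ x in Ioi (0 : ℝ), efrosKernel α 0 t x * (x ^ n * Real.log x) =
      deriv Real.Gamma (n + 1) * rlKernel (α * (n + 1)) t +
        n.factorial * (α * rlKernelDeriv (α * (n + 1)) t) := by
  have hn : (0 : ℝ) < n + 1 := by positivity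
  obtain ⟨C, hC0, hC⟩ := abs_efrosKernel_le hα hα1 ht one_pos
  have hint : IntegrableOn (fun x => (efrosKernel α 0 t x : ℂ)) (Ioi 0) :=
    Integrable.ofReal (integrableOn_efrosKernel hα hα1 ht)
  have hnorm : ∀ x, 0 ≤ x → ‖(efrosKernel α 0 t x : ℂ)‖ ≤ C * Real.exp (-1 * x) := fun x hx => by
    rw [Complex.norm_real]; exact hC x hx
  have htop : (fun x => (efrosKernel α 0 t x : ℂ)) =O[atTop]
      (fun x : ℝ => x ^ (-((n : ℝ) + 2))) := by
    refine Asymptotics.IsBigO.trans (g := fun x => Real.exp (-1 * x)) ?_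
      (isLittleO_exp_neg_mul_rpow_atTop one_pos _).isBigO
    refine Asymptotics.IsBigO.of_bound C ?_
    filter_upwards [eventually_ge_atTop 0] with x hx
    rw [Real.norm_of_nonneg (Real.exp_pos _).le]
    exact hnorm x hx
  have hbot : (fun x => (efrosKernel α 0 t x : ℂ)) =O[𝓝[>] 0] (fun x : ℝ => x ^ (-(0 : ℝ))) := by
    refine Asymptotics.IsBigO.of_bound C ?_
    filter_upwards [self_mem_nhdsWithin] with x hx
    have hx0 : 0 < x := hx
    rw [neg_zero, Real.rpow_zero, norm_one]
    refine (hnorm x hx0.le).trans (mul_le_mul_of_nonneg_left ?_ hC0)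
    rw [Real.exp_le_one_iff]; linarith
  have key := mellin_hasDerivAt_of_isBigO_rpow (s := ((n + 1 : ℝ) : ℂ))
    hint.locallyIntegrableOn htop (by simp only [Complex.ofReal_re]; linarith) hbot
    (by simpa using hn)
  have e : ∀ x ∈ Ioi (0 : ℝ), (x : ℂ) ^ (((n + 1 : ℝ) : ℂ) - 1) •
      (Real.log x • (efrosKernel α 0 t x : ℂ)) =
      ((efrosKernel α 0 t x * (x ^ n * Real.log x) : ℝ) : ℂ) := by
    intro x _
    have : ((n + 1 : ℝ) : ℂ) - 1 = n := by push_cast; ring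
    rw [this, Complex.cpow_natCast, smul_eq_mul, Complex.real_smul]
    push_cast
    ring
  have hi : IntegrableOn (fun x => ((efrosKernel α 0 t x * (x ^ n * Real.log x) : ℝ) : ℂ))
      (Ioi 0) := IntegrableOn.congr_fun key.1 e measurableSet_Ioi
  refine ⟨hi.re, ?_⟩
  have hM : ∀ s : ℝ, 0 < s → mellin (fun x => (efrosKernel α 0 t x : ℂ)) s =
      ((Real.Gamma s * rlKernel (α * s) t : ℝ) : ℂ) := by
    intro s hs
    have h := (integral_efrosKernel_mul_rpow hα hα1 ht (p := s - 1) (by linarith)).2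
    rw [sub_add_cancel] at h
    rw [← h, ← integral_complex_ofReal, mellin]
    refine setIntegral_congr_fun measurableSet_Ioi fun x hx => ?_
    simp only [smul_eq_mul]
    push_cast [Complex.ofReal_cpow (le_of_lt hx)]
    ring
  have h1 := key.2.comp_ofReal
  have h3 : HasDerivAt (fun s : ℝ => rlKernel (α * s) t)
      (rlKernelDeriv (α * (n + 1)) t * (α * 1)) (n + 1 : ℝ) :=
    (hasDerivAt_rlKernel (by positivity) ht).comp (n + 1 : ℝ)
      ((hasDerivAt_id (n + 1 : ℝ)).const_mul α)
  have h2 := HasDerivAt.ofReal_comp ((differentiableAt_Gamma_of_pos hn).hasDerivAt.mul h3)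
  have h4 := h1.unique (h2.congr_of_eventuallyEq (by
    filter_upwards [lt_mem_nhds hn] with s hs
    exact hM s hs))
  rw [mellin, setIntegral_congr_fun measurableSet_Ioi e, integral_complex_ofReal,
    Complex.ofReal_inj, Real.Gamma_nat_eq_factorial] at h4
  rw [h4]
  ring

theorem integrableOn_exp_mul_exp_mul_log {lam κ c : ℝ} (h : lam < κ) :
    IntegrableOn (fun x => Real.exp (-κ * x) * (Real.exp (lam * x) * (|Real.log x| + c)))
      (Ioi 0) := by
  refine (integrableOn_exp_neg_mul_abs_log (k := κ - lam) (c := c) (by linarith)).congr_fun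
    (fun x _ => ?_) measurableSet_Ioi
  simp only
  rw [← mul_assoc, ← Real.exp_add]
  ring_nf

theorem integrableOn_efrosKernel_mul_exp_mul_abs_log (hα : 0 < α) (hα1 : α < 1) (ht : 0 < t)
    (lam c : ℝ) : IntegrableOn
      (fun x => efrosKernel α 0 t x * (Real.exp (lam * x) * (|Real.log x| + c))) (Ioi 0) :=
  integrableOn_efrosKernel_mul hα hα1 ht (κ := |lam| + 1) (by positivity)
    (integrableOn_exp_mul_exp_mul_log (by linarith [le_abs_self lam]))

theorem integrableOn_efrosKernel_mul_exp_mul_log (hα : 0 < α) (hα1 : α < 1) (ht : 0 < t)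
    (lam c : ℝ) : IntegrableOn
      (fun x => efrosKernel α 0 t x * (Real.exp (lam * x) * (Real.log x + c))) (Ioi 0) := by
  refine Integrable.mono (integrableOn_efrosKernel_mul_exp_mul_abs_log hα hα1 ht lam |c|) ?_ ?_
  · have h1 := (integrableOn_efrosKernel hα hα1 ht).aestronglyMeasurable
    exact h1.mul (by fun_prop)
  · refine Eventually.of_forall fun x => ?_
    rw [norm_mul, norm_mul, norm_mul, norm_mul]
    have : ‖Real.log x + c‖ ≤ ‖|Real.log x| + |c|‖ := by
      rw [Real.norm_eq_abs, Real.norm_of_nonneg (by positivity)]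
      exact abs_add_le _ _
    gcongr

theorem hasSum_integral_efrosKernel_mul_exp_mul_log (hα : 0 < α) (hα1 : α < 1) (ht : 0 < t)
    (lam : ℝ) : HasSum (fun n : ℕ => lam ^ n * efrosTerm α n t)
      (∫ x in Ioi (0 : ℝ), efrosKernel α 0 t x *
        (Real.exp (lam * x) * (Real.log x + Real.eulerMascheroniConstant))) := by
  set g := Real.eulerMascheroniConstant with hg
  have hexp : ∀ y : ℝ, HasSum (fun k : ℕ => y ^ k / (k.factorial : ℝ)) (Real.exp y) := fun y => by
    rw [Real.exp_eq_exp_ℝ]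
    exact NormedSpace.expSeries_div_hasSum_exp y
  have hm := (integrableOn_efrosKernel hα hα1 ht).aestronglyMeasurable
  have hb : ∀ x : ℝ, HasSum (fun k : ℕ => |efrosKernel α 0 t x| *
      ((|lam| * |x|) ^ k / (k.factorial : ℝ) * (|Real.log x| + |g|)))
      (|efrosKernel α 0 t x| * (Real.exp (|lam| * |x|) * (|Real.log x| + |g|))) := fun x =>
    ((hexp _).mul_right _).mul_left _
  have h := hasSum_integral_of_dominated_convergence (μ := volume.restrict (Ioi (0 : ℝ)))
    (F := fun (k : ℕ) x => efrosKernel α 0 t x *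
      ((lam * x) ^ k / (k.factorial : ℝ) * (Real.log x + g)))
    (f := fun x => efrosKernel α 0 t x * (Real.exp (lam * x) * (Real.log x + g)))
    (fun k x => |efrosKernel α 0 t x| *
      ((|lam| * |x|) ^ k / (k.factorial : ℝ) * (|Real.log x| + |g|)))
    (fun k => hm.mul (by fun_prop))
    (fun k => Eventually.of_forall fun x => ?_)
    (Eventually.of_forall fun x => (hb x).summable)
    (((integrableOn_efrosKernel_mul_exp_mul_abs_log hα hα1 ht |lam| |g|).norm).congr ?_)
    (Eventually.of_forall fun x => ((hexp _).mul_right _).mul_left _)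
  · refine h.congr_fun fun n => ?_
    obtain ⟨h1, h2⟩ := integral_efrosKernel_mul_pow hα hα1 ht n
    obtain ⟨h3, h4⟩ := integral_efrosKernel_mul_pow_mul_log hα hα1 ht n
    have e : ∀ x, efrosKernel α 0 t x * ((lam * x) ^ n / (n.factorial : ℝ) * (Real.log x + g)) =
        lam ^ n / n.factorial * (efrosKernel α 0 t x * (x ^ n * Real.log x) +
          g * (efrosKernel α 0 t x * x ^ n)) := fun x => by rw [mul_pow]; ring
    simp only [e]
    -- Since Γ'(n+1) = n! (H_n - γ₀), the added constant γ₀ cancels and only H_n is left.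
    rw [integral_const_mul, integral_add h3 (h1.const_mul _), integral_const_mul, h2, h4,
      Real.deriv_Gamma_nat, efrosTerm, ← hg]
    have : (n.factorial : ℝ) ≠ 0 := by positivity
    field_simp
    ring
  · rw [norm_mul, norm_mul, norm_div, norm_pow, norm_mul]
    simp only [Real.norm_eq_abs, Nat.abs_cast]
    gcongr
    exact abs_add_le _ _
  · filter_upwards [self_mem_ae_restrict measurableSet_Ioi] with x hx
    rw [(hb x).tsum_eq, norm_mul, Real.norm_eq_abs, Real.norm_of_nonneg (by positivity),
      abs_of_pos (show 0 < x from hx)]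

end LogMoment

theorem hasSum_efrosTransform {α t : ℝ} (hα : 0 < α) (hα1 : α ≤ 1) (ht : 0 < t) (lam : ℝ) :
    HasSum (fun n : ℕ => lam ^ n * efrosTerm α n t)
      (efrosTransform α
        (fun x => Real.exp (lam * x) * (Real.log x + Real.eulerMascheroniConstant)) t) := by
  rcases hα1.lt_or_eq with h | rfl
  · rw [efrosTransform, if_neg h.ne]
    exact hasSum_integral_efrosKernel_mul_exp_mul_log hα h ht lam
  · rw [efrosTransform, if_pos rfl]
    have hexp : HasSum (fun k : ℕ => (lam * t) ^ k / (k.factorial : ℝ)) (Real.exp (lam * t)) := by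
      rw [Real.exp_eq_exp_ℝ]
      exact NormedSpace.expSeries_div_hasSum_exp _
    -- For the delta kernel the cancellation is the reverse one: ψ(n+1) = H_n - γ₀, so the n-th term
    -- reduces to (λt)^n/n! (ln t + γ₀).
    refine (hexp.mul_right _).congr_fun fun n => ?_
    rw [efrosTerm, rlKernelDeriv, one_mul, realDigamma_nat_add_one, rlKernel,
      Real.Gamma_nat_eq_factorial, add_sub_cancel_right, Real.rpow_natCast, mul_pow]
    ring

/-! ### Rising factorial coefficients and Chu–Vandermonde -/

/-- The coefficient `(g)ₖ / k!`. -/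
noncomputable def risingBinom (g : ℝ) (k : ℕ) : ℝ := (ascPochhammer ℝ k).eval g / k.factorial

/-- The derivative of `(g)ₖ / k!` with respect to `g`. -/
noncomputable def risingBinomDeriv (g : ℝ) (k : ℕ) : ℝ :=
  (Polynomial.derivative (ascPochhammer ℝ k)).eval g / k.factorial

theorem hasDerivAt_risingBinom (g : ℝ) (k : ℕ) :
    HasDerivAt (fun g => risingBinom g k) (risingBinomDeriv g k) g :=
  ((ascPochhammer ℝ k).hasDerivAt g).div_const _

theorem risingBinom_zero (g : ℝ) : risingBinom g 0 = 1 := by simp [risingBinom]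

theorem risingBinomDeriv_zero (g : ℝ) : risingBinomDeriv g 0 = 0 := by simp [risingBinomDeriv]

theorem succ_mul_risingBinom (g : ℝ) (k : ℕ) :
    (k + 1) * risingBinom g (k + 1) = (g + k) * risingBinom g k := by
  rw [risingBinom, risingBinom, ascPochhammer_succ_eval, Nat.factorial_succ]
  push_cast
  have : (k.factorial : ℝ) ≠ 0 := by positivity
  field_simp

theorem succ_mul_risingBinomDeriv (g : ℝ) (k : ℕ) :
    (k + 1) * risingBinomDeriv g (k + 1) = (g + k) * risingBinomDeriv g k + risingBinom g k := by
  have h1 := (hasDerivAt_risingBinom g (k + 1)).const_mul ((k : ℝ) + 1)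
  simp only [succ_mul_risingBinom] at h1
  have h2 := ((hasDerivAt_id g).add_const (k : ℝ)).mul (hasDerivAt_risingBinom g k)
  have := h1.unique h2
  simp only [id] at this
  linarith

theorem risingBinom_one (k : ℕ) : risingBinom 1 k = 1 := by
  rw [risingBinom, ascPochhammer_eval_one, div_self (by positivity)]

theorem risingBinomDeriv_one (k : ℕ) : risingBinomDeriv 1 k = harmonic k := by
  induction k with
  | zero => simp [risingBinomDeriv_zero]
  | succ k ih =>
    have h := succ_mul_risingBinomDeriv 1 k
    rw [ih, risingBinom_one] at h
    have hk : (k : ℝ) + 1 ≠ 0 := by positivity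
    rw [harmonic_succ]
    push_cast
    field_simp
    linarith

/-- The Chu–Vandermonde identity. -/
theorem sum_risingBinom_mul_risingBinom (g h : ℝ) (N : ℕ) :
    ∑ p ∈ Finset.HasAntidiagonal.antidiagonal N, risingBinom g p.1 * risingBinom h p.2 = risingBinom (g + h) N := by
  induction N with
  | zero => simp [risingBinom_zero]
  | succ N ih =>
    -- Weighting each term by p.1 + p.2 = N + 1 lets the one-step recurrence reduce both halves to
    -- the antidiagonal of N.
    have h1 : ∑ p ∈ Finset.HasAntidiagonal.antidiagonal (N + 1), (p.1 : ℝ) * (risingBinom g p.1 * risingBinom h p.2) =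
        ∑ p ∈ Finset.HasAntidiagonal.antidiagonal N, (g + p.1) * (risingBinom g p.1 * risingBinom h p.2) := by
      rw [Finset.Nat.sum_antidiagonal_succ]
      simp only [Nat.cast_zero, zero_mul, zero_add, Nat.cast_add, Nat.cast_one]
      refine Finset.sum_congr rfl fun p _ => ?_
      rw [← mul_assoc, succ_mul_risingBinom, mul_assoc]
    have h2 : ∑ p ∈ Finset.HasAntidiagonal.antidiagonal (N + 1), (p.2 : ℝ) * (risingBinom g p.1 * risingBinom h p.2) =
        ∑ p ∈ Finset.HasAntidiagonal.antidiagonal N, (h + p.2) * (risingBinom g p.1 * risingBinom h p.2) := by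
      rw [Finset.Nat.sum_antidiagonal_succ']
      simp only [Nat.cast_zero, zero_mul, zero_add, Nat.cast_add, Nat.cast_one]
      refine Finset.sum_congr rfl fun p _ => ?_
      rw [mul_left_comm, succ_mul_risingBinom]
      ring
    have h3 : ((N : ℝ) + 1) * ∑ p ∈ Finset.HasAntidiagonal.antidiagonal (N + 1),
        risingBinom g p.1 * risingBinom h p.2 = (g + h + N) * risingBinom (g + h) N := by
      calc _ = ∑ p ∈ Finset.HasAntidiagonal.antidiagonal (N + 1),
            ((p.1 : ℝ) * (risingBinom g p.1 * risingBinom h p.2) +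
              (p.2 : ℝ) * (risingBinom g p.1 * risingBinom h p.2)) := by
            rw [Finset.mul_sum]
            refine Finset.sum_congr rfl fun p hp => ?_
            have : ((p.1 + p.2 : ℕ) : ℝ) = ((N + 1 : ℕ) : ℝ) := by
              rw [Finset.HasAntidiagonal.mem_antidiagonal.1 hp]
            push_cast at this
            rw [← this]; ring
        _ = ∑ p ∈ Finset.HasAntidiagonal.antidiagonal N, (g + h + N) * (risingBinom g p.1 * risingBinom h p.2) := by
            rw [Finset.sum_add_distrib, h1, h2, ← Finset.sum_add_distrib]
            refine Finset.sum_congr rfl fun p hp => ?_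
            have : ((p.1 + p.2 : ℕ) : ℝ) = (N : ℝ) := by rw [Finset.HasAntidiagonal.mem_antidiagonal.1 hp]
            push_cast at this
            rw [← this]; ring
        _ = _ := by rw [← Finset.mul_sum, ih]
    rw [← succ_mul_risingBinom] at h3
    exact mul_left_cancel₀ (by positivity) h3

theorem sum_risingBinom (g : ℝ) (N : ℕ) :
    ∑ p ∈ Finset.HasAntidiagonal.antidiagonal N, risingBinom (g - 1) p.1 = risingBinom g N := by
  have := sum_risingBinom_mul_risingBinom (g - 1) 1 N
  simpa [risingBinom_one] using this

/-- Differentiate Chu–Vandermonde in its second parameter at 1, where the derivative of (h)_k/k! is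
the harmonic number. -/
theorem sum_risingBinom_mul_harmonic (g : ℝ) (N : ℕ) :
    ∑ p ∈ Finset.HasAntidiagonal.antidiagonal N, risingBinom (g - 1) p.1 * harmonic p.2 = risingBinomDeriv g N := by
  have h1 : HasDerivAt (fun h => ∑ p ∈ Finset.HasAntidiagonal.antidiagonal N,
      risingBinom (g - 1) p.1 * risingBinom h p.2)
      (∑ p ∈ Finset.HasAntidiagonal.antidiagonal N, risingBinom (g - 1) p.1 * risingBinomDeriv 1 p.2) 1 :=
    HasDerivAt.fun_sum fun p _ => (hasDerivAt_risingBinom 1 p.2).const_mul _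
  simp only [sum_risingBinom_mul_risingBinom, risingBinomDeriv_one] at h1
  have h2 := (hasDerivAt_risingBinom (g - 1 + 1) N).comp_const_add (g - 1) 1
  rw [h1.unique h2, sub_add_cancel]

/-- Geometric growth is crude but sufficient against the Gamma denominators; the induction uses |g +
k| ≤ R (k+1). -/
theorem abs_risingBinom_le {g R : ℝ} (hR : 1 ≤ R) (hg : |g| ≤ R) (k : ℕ) :
    |risingBinom g k| ≤ R ^ k ∧ |risingBinomDeriv g k| ≤ k * R ^ k := by
  induction k with
  | zero => simp [risingBinom_zero, risingBinomDeriv_zero]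
  | succ k ih =>
    have hk : (0 : ℝ) < k + 1 := by positivity
    have h0 : |g + k| ≤ R * (k + 1) := by
      refine (abs_add_le _ _).trans ?_
      rw [Nat.abs_cast]
      have : (0 : ℝ) ≤ k := k.cast_nonneg
      nlinarith
    have hRk : 0 < R ^ k := by positivity
    constructor
    · have h1 := congrArg abs (succ_mul_risingBinom g k)
      rw [abs_mul, abs_mul, abs_of_pos hk] at h1
      have h2 : |g + k| * |risingBinom g k| ≤ R * (k + 1) * R ^ k := by gcongr; exact ih.1
      rw [← h1] at h2
      refine le_of_mul_le_mul_left (h2.trans (le_of_eq ?_)) hk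
      ring
    · have h1 := congrArg abs (succ_mul_risingBinomDeriv g k)
      rw [abs_mul, abs_of_pos hk] at h1
      have h2 : |(g + k) * risingBinomDeriv g k + risingBinom g k| ≤
          R * (k + 1) * (k * R ^ k) + R ^ k := by
        refine (abs_add_le _ _).trans (add_le_add ?_ ih.1)
        rw [abs_mul]
        gcongr
        exact ih.2
      rw [← h1] at h2
      refine le_of_mul_le_mul_left (h2.trans ?_) hk
      push_cast
      have h3 : R ^ k ≤ (k + 1) * R * R ^ k := by
        have : (0 : ℝ) ≤ k := k.cast_nonneg
        have : 1 ≤ (k + 1) * R := by nlinarith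
        nlinarith
      calc R * (k + 1) * (k * R ^ k) + R ^ k
          ≤ R * (k + 1) * (k * R ^ k) + (k + 1) * R * R ^ k := by gcongr
        _ = _ := by ring

/-! ### Dominated series of Mittag-Leffler type -/

theorem rlKernel_pos {a t : ℝ} (ha : 0 < a) (ht : 0 < t) : 0 < rlKernel a t :=
  div_pos (Real.rpow_pos_of_pos ht _) (Real.Gamma_pos_of_pos ha)

theorem rlKernel_mul_add_le {a b s T : ℝ} (ha : 0 < a) (hb : 0 < b) (hs : 0 < s) (hsT : s ≤ T)
    (k : ℕ) : rlKernel (a * k + b) s ≤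
      Real.Gamma b * ((T ^ a) ^ k / Real.Gamma (a * k + b)) * rlKernel b s := by
  have hGb := Real.Gamma_pos_of_pos hb
  have hG := Real.Gamma_pos_of_pos (by positivity : 0 < a * k + b)
  have e : s ^ (a * k + b - 1) = (s ^ a) ^ k * s ^ (b - 1) := by
    rw [← Real.rpow_natCast, ← Real.rpow_mul hs.le, ← Real.rpow_add hs]; ring_nf
  have h1 : (s ^ a) ^ k ≤ (T ^ a) ^ k := by gcongr
  have hsb := Real.rpow_pos_of_pos hs (b - 1)
  rw [rlKernel, rlKernel, e]
  calc (s ^ a) ^ k * s ^ (b - 1) / Real.Gamma (a * k + b)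
      ≤ (T ^ a) ^ k * s ^ (b - 1) / Real.Gamma (a * k + b) := by gcongr
    _ = _ := by field_simp

theorem summable_mul_pow_div_Gamma {a b x T : ℝ} (ha : 0 < a) (hb : 0 < b) (hx : 0 ≤ x)
    (hT : 0 ≤ T) :
    Summable fun k : ℕ => (k + 1) * x ^ k * (Real.Gamma b * ((T ^ a) ^ k / Real.Gamma (a * k + b))) := by
  have h := (summable_pow_div_Gamma ha hb (x := 2 * x * T ^ a) (by positivity)).mul_left
    (Real.Gamma b)
  refine Summable.of_nonneg_of_le (fun k => ?_) (fun k => ?_) h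
  · have := Real.Gamma_pos_of_pos hb
    have := Real.Gamma_pos_of_pos (by positivity : 0 < a * k + b)
    positivity
  · have := Real.Gamma_pos_of_pos hb
    have := Real.Gamma_pos_of_pos (by positivity : 0 < a * k + b)
    -- The linear factor is absorbed by doubling the base of the power series.
    have h2 : (k : ℝ) + 1 ≤ 2 ^ k := by exact_mod_cast Nat.lt_two_pow_self (n := k)
    calc _ ≤ 2 ^ k * x ^ k * (Real.Gamma b * ((T ^ a) ^ k / Real.Gamma (a * k + b))) := by gcongr
      _ = _ := by rw [mul_pow, mul_pow]; ring

/-- Termwise integration of a series that is dominated on an interval. -/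
theorem hasSum_integral_of_le_mul {ι : Type*} [Countable ι] {S : Set ℝ} (hS : MeasurableSet S)
    {f : ι → ℝ → ℝ} {F w : ℝ → ℝ} {C : ι → ℝ} (hC : Summable C)
    (hw : IntegrableOn w S) (hf : ∀ i, AEStronglyMeasurable (f i) (volume.restrict S))
    (hle : ∀ i, ∀ s ∈ S, |f i s| ≤ C i * w s) (hF : ∀ s ∈ S, HasSum (fun i => f i s) (F s)) :
    IntegrableOn F S ∧ HasSum (fun i => ∫ s in S, f i s) (∫ s in S, F s) := by
  have hS' := self_mem_ae_restrict (μ := volume) hS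
  constructor
  · have hFm : AEStronglyMeasurable F (volume.restrict S) := by
      refine aestronglyMeasurable_of_tendsto_ae (atTop : Filter (Finset ι))
        (f := fun J s => ∑ i ∈ J, f i s) (fun J => ?_) ?_
      · exact Finset.aestronglyMeasurable_fun_sum J fun i _ => hf i
      · filter_upwards [hS'] with s hs using hF s hs
    refine Integrable.mono' (hw.const_mul (∑' i, C i)) hFm ?_
    filter_upwards [hS'] with s hs
    rw [← (hF s hs).tsum_eq]
    exact tsum_of_norm_bounded (hC.hasSum.mul_right (w s)) fun i => hle i s hs
  · refine hasSum_integral_of_dominated_convergence (fun i s => C i * w s) hf (fun i => ?_) ?_ ?_ ?_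
    · filter_upwards [hS'] with s hs using hle i s hs
    · exact Eventually.of_forall fun s => hC.mul_right _
    · simp only [tsum_mul_right]
      exact hw.const_mul _
    · filter_upwards [hS'] with s hs using hF s hs

/-- A summable bound for the coefficients of Mittag-Leffler type series. -/
noncomputable def mlBound (a b x T : ℝ) (k : ℕ) : ℝ :=
  (k + 1) * x ^ k * (Real.Gamma b * ((T ^ a) ^ k / Real.Gamma (a * k + b)))

theorem summable_mlBound {a b x T : ℝ} (ha : 0 < a) (hb : 0 < b) (hx : 0 ≤ x) (hT : 0 ≤ T) :
    Summable (mlBound a b x T) :=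
  summable_mul_pow_div_Gamma ha hb hx hT

theorem mlBound_nonneg {a b x T : ℝ} (ha : 0 < a) (hb : 0 < b) (hx : 0 ≤ x) (hT : 0 ≤ T) (k : ℕ) :
    0 ≤ mlBound a b x T k := by
  have := Real.Gamma_pos_of_pos hb
  have := Real.Gamma_pos_of_pos (by positivity : 0 < a * k + b)
  unfold mlBound
  positivity

section Series

variable {a b g lam s t T : ℝ}

theorem abs_mul_rlKernel_le (ha : 0 < a) (hb : 0 < b) (hs : 0 < s) (hsT : s ≤ T) {R : ℝ}
    (hR : 1 ≤ R) {q : ℝ} {k : ℕ} (hq : |q| ≤ (k + 1) * R ^ k) :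
    |q * lam ^ k * rlKernel (a * k + b) s| ≤ mlBound a b (R * |lam|) T k * rlKernel b s := by
  have h1 := rlKernel_mul_add_le ha hb hs hsT k
  have h2 := rlKernel_pos (by positivity : 0 < a * k + b) hs
  rw [abs_mul, abs_mul, abs_pow, abs_of_pos h2, mlBound, mul_pow]
  calc |q| * |lam| ^ k * rlKernel (a * k + b) s
      ≤ (k + 1) * R ^ k * |lam| ^ k *
        (Real.Gamma b * ((T ^ a) ^ k / Real.Gamma (a * k + b)) * rlKernel b s) := by gcongr
    _ = _ := by ring

theorem abs_risingBinom_le_succ {R : ℝ} (hR : 1 ≤ R) (hg : |g| ≤ R) (k : ℕ) :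
    |risingBinom g k| ≤ (k + 1) * R ^ k := by
  have h1 := (abs_risingBinom_le hR hg k).1
  have : 0 ≤ (k : ℝ) * R ^ k := by positivity
  linarith

theorem abs_risingBinomDeriv_le_succ {R : ℝ} (hR : 1 ≤ R) (hg : |g| ≤ R) (k : ℕ) :
    |risingBinomDeriv g k| ≤ (k + 1) * R ^ k := by
  have h1 := (abs_risingBinom_le hR hg k).2
  have : 0 ≤ R ^ k := by positivity
  linarith

theorem prabhakar_term (ht : 0 < t) (k : ℕ) :
    t ^ (b - 1) * ((ascPochhammer ℝ k).eval g * (lam * t ^ a) ^ k /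
      ((k.factorial : ℝ) * Real.Gamma (a * k + b))) =
      risingBinom g k * lam ^ k * rlKernel (a * k + b) t := by
  have e : t ^ (a * k + b - 1) = (t ^ a) ^ k * t ^ (b - 1) := by
    rw [← Real.rpow_natCast, ← Real.rpow_mul ht.le, ← Real.rpow_add ht]; ring_nf
  rw [rlKernel, e, risingBinom, mul_pow]
  ring

theorem hasSum_prabhakar (ha : 0 < a) (hb : 0 < b) (ht : 0 < t) (g lam : ℝ) :
    HasSum (fun k : ℕ => risingBinom g k * lam ^ k * rlKernel (a * k + b) t)
      (t ^ (b - 1) * prabhakar a b g (lam * t ^ a)) := by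
  have h1 : Summable fun k : ℕ => risingBinom g k * lam ^ k * rlKernel (a * k + b) t := by
    have hR : 1 ≤ |g| + 1 := by linarith [abs_nonneg g]
    refine Summable.of_norm_bounded ((summable_mlBound (x := (|g| + 1) * |lam|) (T := t) ha hb
      (by positivity) ht.le).mul_right (rlKernel b t)) fun k => ?_
    exact abs_mul_rlKernel_le ha hb ht le_rfl hR (abs_risingBinom_le_succ hR (by linarith) k)
  have h2 := h1.hasSum
  rwa [← tsum_congr (prabhakar_term ht), tsum_mul_left] at h2

/-- Termwise differentiation, with a majorant uniform over the parameters in the ball of radius |g|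
+ 1. -/
theorem hasDerivAt_prabhakar (ha : 0 < a) (hb : 0 < b) (ht : 0 < t) (g lam : ℝ) :
    Summable (fun k : ℕ => risingBinomDeriv g k * lam ^ k * rlKernel (a * k + b) t) ∧
    HasDerivAt (fun g => t ^ (b - 1) * prabhakar a b g (lam * t ^ a))
      (∑' k : ℕ, risingBinomDeriv g k * lam ^ k * rlKernel (a * k + b) t) g := by
  set R := |g| + 1 with hRdef
  have hR : 1 ≤ R := by linarith [abs_nonneg g]
  have hu := (summable_mlBound (x := R * |lam|) (T := t) ha hb
      (by positivity) ht.le).mul_right (rlKernel b t)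
  have hle : ∀ (k : ℕ) (y : ℝ), y ∈ Metric.ball (0 : ℝ) R →
      ‖risingBinomDeriv y k * lam ^ k * rlKernel (a * k + b) t‖ ≤
        mlBound a b (R * |lam|) t k * rlKernel b t := fun k y hy => by
    rw [mem_ball_zero_iff] at hy
    exact abs_mul_rlKernel_le ha hb ht le_rfl hR (abs_risingBinomDeriv_le_succ hR hy.le k)
  have hg : g ∈ Metric.ball (0 : ℝ) R := by
    rw [mem_ball_zero_iff, Real.norm_eq_abs]; linarith
  refine ⟨Summable.of_norm_bounded hu fun k => hle k g hg, ?_⟩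
  have h := hasDerivAt_tsum_of_isPreconnected hu Metric.isOpen_ball
    (convex_ball (0 : ℝ) R).isPreconnected
    (fun k y _ => ((hasDerivAt_risingBinom y k).mul_const (lam ^ k)).mul_const
      (rlKernel (a * k + b) t)) hle hg (hasSum_prabhakar ha hb ht g lam).summable hg
  refine h.congr_of_eventuallyEq (Eventually.of_forall fun y => ?_)
  exact (hasSum_prabhakar ha hb ht y lam).tsum_eq.symm

theorem measurable_rlKernel : Measurable (rlKernel a) := by
  unfold rlKernel; fun_prop

theorem measurable_rlKernelDeriv : Measurable (rlKernelDeriv a) := by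
  unfold rlKernelDeriv
  exact measurable_rlKernel.mul (by fun_prop)

theorem measurable_efrosTerm (n : ℕ) : Measurable (efrosTerm a n) := by
  unfold efrosTerm
  exact (measurable_rlKernel.const_mul _).add (measurable_rlKernelDeriv.const_mul _)

/-! ### The two convolutions -/

theorem integral_rlKernelDeriv_mul_rlKernel (ha : 0 < a) (hb : 0 < b) (ht : 0 < t) :
    IntegrableOn (fun s => rlKernelDeriv a (t - s) * rlKernel b s) (Ioo 0 t) ∧
      ∫ s in Ioo 0 t, rlKernelDeriv a (t - s) * rlKernel b s = rlKernelDeriv (a + b) t := by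
  obtain ⟨h1, h2⟩ := integral_rlKernel_mul_rlKernelDeriv hb ha ht
  rw [← intervalIntegrable_iff_integrableOn_Ioo_of_le ht.le] at h1 ⊢
  rw [← integral_Ioc_eq_integral_Ioo, ← intervalIntegral.integral_of_le ht.le] at h2 ⊢
  constructor
  · have h3 := (h1.comp_sub_left t).symm
    rw [sub_zero, sub_self] at h3
    refine h3.congr fun s _ => ?_
    simp only [sub_sub_cancel]
    rw [mul_comm]
  · have h3 := intervalIntegral.integral_comp_sub_left (a := 0) (b := t)
      (fun s => rlKernel b (t - s) * rlKernelDeriv a s) t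
    rw [sub_zero, sub_self, h2] at h3
    rw [add_comm a b, ← h3]
    simp only [sub_sub_cancel, mul_comm]

/-- The convolution of `log + γ₀` with a function of Prabhakar type. -/
theorem log_convolution_prabhakar (ha : 0 < a) (hb : 0 < b) (ht : 0 < t) (g lam : ℝ) :
    IntegrableOn (fun s => (Real.log (t - s) + Real.eulerMascheroniConstant) *
      (s ^ (b - 1) * prabhakar a b g (lam * s ^ a))) (Ioo 0 t) ∧
    HasSum (fun k : ℕ => risingBinom g k * lam ^ k * rlKernelDeriv (a * k + (b + 1)) t)
      (∫ s in Ioo 0 t, (Real.log (t - s) + Real.eulerMascheroniConstant) *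
        (s ^ (b - 1) * prabhakar a b g (lam * s ^ a))) := by
  have hR : 1 ≤ |g| + 1 := by linarith [abs_nonneg g]
  have h := hasSum_integral_of_le_mul (S := Ioo 0 t) measurableSet_Ioo
    (f := fun k s => rlKernelDeriv 1 (t - s) * (risingBinom g k * lam ^ k * rlKernel (a * k + b) s))
    (F := fun s => (Real.log (t - s) + Real.eulerMascheroniConstant) *
      (s ^ (b - 1) * prabhakar a b g (lam * s ^ a)))
    (summable_mlBound (x := (|g| + 1) * |lam|) (T := t) ha hb (by positivity) ht.le)
    (integral_rlKernelDeriv_mul_rlKernel one_pos hb ht).1.norm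
    (fun k => ?_) (fun k s hs => ?_) (fun s hs => ?_)
  · refine ⟨h.1, h.2.congr_fun fun k => ?_⟩
    have hk : 0 < a * k + b := by positivity
    have e : ∀ s, rlKernelDeriv 1 (t - s) * (risingBinom g k * lam ^ k * rlKernel (a * k + b) s) =
        risingBinom g k * lam ^ k * (rlKernelDeriv 1 (t - s) * rlKernel (a * k + b) s) :=
      fun s => by ring
    simp only [e]
    rw [integral_const_mul, (integral_rlKernelDeriv_mul_rlKernel one_pos hk ht).2]
    ring_nf
  · exact ((measurable_rlKernelDeriv.comp (measurable_const.sub measurable_id)).mul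
      (measurable_rlKernel.const_mul _)).aestronglyMeasurable
  · have h1 := abs_mul_rlKernel_le (lam := lam) ha hb hs.1 hs.2.le hR
      (abs_risingBinom_le_succ hR (by linarith : |g| ≤ |g| + 1) k)
    rw [abs_mul, norm_mul, Real.norm_eq_abs, Real.norm_of_nonneg (rlKernel_pos hb hs.1).le]
    calc _ ≤ |rlKernelDeriv 1 (t - s)| * (mlBound a b ((|g| + 1) * |lam|) t k * rlKernel b s) := by
          gcongr
      _ = _ := by ring
  · rw [← rlKernelDeriv_one]
    exact (hasSum_prabhakar ha hb hs.1 g lam).mul_left _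

theorem harmonic_le_natCast (n : ℕ) : (harmonic n : ℝ) ≤ n := by
  induction n with
  | zero => simp
  | succ n ih =>
    have h : ((n : ℝ) + 1)⁻¹ ≤ 1 := inv_le_one_of_one_le₀ (by simp)
    rw [harmonic_succ]
    push_cast
    linarith

/-- H_n and ψ(an+a) both grow at most linearly in n, which costs one factor n + 1; what remains is a
fixed integrable weight with a logarithmic singularity. -/
theorem abs_efrosTerm_le (ha : 0 < a) (ha1 : a ≤ 1) (hs : 0 < s) (hsT : s ≤ T) (n : ℕ) :
    |lam ^ n * efrosTerm a n s| ≤ (2 + |realDigamma a|) * mlBound a a |lam| T n *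
      (rlKernel a s * (1 + |Real.log s|)) := by
  have hn : (0 : ℝ) ≤ n := n.cast_nonneg
  have e : a * ((n : ℝ) + 1) = a * n + a := by ring
  have h1 := rlKernel_mul_add_le ha ha hs hsT n
  have h2 := rlKernel_pos (by positivity : 0 < a * n + a) hs
  have hψ := abs_realDigamma_le ha (by nlinarith : a ≤ a * n + a)
  have hH0 : (0 : ℝ) ≤ harmonic n := by
    rw [harmonic]; push_cast; positivity
  have hH := harmonic_le_natCast n
  have h3 : |(harmonic n + a * (Real.log s - realDigamma (a * n + a)) : ℝ)| ≤
      (n + 1) * (2 + |realDigamma a|) * (1 + |Real.log s|) := by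
    have hl := abs_nonneg (Real.log s)
    have hd := abs_nonneg (realDigamma a)
    have h4 : |Real.log s - realDigamma (a * n + a)| ≤
        |Real.log s| + (|realDigamma a| + (n + 1)) := by
      refine (abs_sub _ _).trans (add_le_add le_rfl (hψ.trans ?_))
      nlinarith
    have h5 : |a * (Real.log s - realDigamma (a * n + a))| ≤
        |Real.log s| + (|realDigamma a| + (n + 1)) := by
      rw [abs_mul, abs_of_pos ha]
      have := abs_nonneg (Real.log s - realDigamma (a * n + a))
      nlinarith
    refine (abs_add_le _ _).trans ?_
    rw [abs_of_nonneg hH0]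
    have h6 : n + (|Real.log s| + (|realDigamma a| + (n + 1))) ≤
        (n + 1) * (2 + |realDigamma a|) * (1 + |Real.log s|) := by
      have := mul_nonneg hn hl
      have := mul_nonneg hn hd
      have := mul_nonneg hd hl
      have := mul_nonneg hn (mul_nonneg hd hl)
      nlinarith
    linarith
  have e2 : lam ^ n * efrosTerm a n s = lam ^ n * (rlKernel (a * n + a) s *
      (harmonic n + a * (Real.log s - realDigamma (a * n + a)))) := by
    rw [efrosTerm, rlKernelDeriv, e]; ring
  rw [e2, abs_mul, abs_mul, abs_pow, abs_of_pos h2, mlBound]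
  calc _ ≤ |lam| ^ n * ((Real.Gamma a * ((T ^ a) ^ n / Real.Gamma (a * n + a)) * rlKernel a s) *
        ((n + 1) * (2 + |realDigamma a|) * (1 + |Real.log s|))) := by gcongr; exact h2.le.trans h1
    _ = _ := by ring

theorem integrableOn_rlKernel_mul_log (ha : 0 < a) (hb : 0 < b) (ht : 0 < t) :
    IntegrableOn (fun s => rlKernel b (t - s) * (rlKernel a s * (1 + |Real.log s|))) (Ioo 0 t) := by
  obtain ⟨h1, -⟩ := integral_rlKernel_mul_rlKernel hb ha ht
  obtain ⟨h2, -⟩ := integral_rlKernel_mul_rlKernelDeriv hb ha ht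
  have h3 := h1.add (h2.add (h1.const_mul (realDigamma a))).norm
  refine IntegrableOn.congr_fun h3 (fun s hs => ?_) measurableSet_Ioo
  have e : rlKernel b (t - s) * rlKernelDeriv a s + realDigamma a *
      (rlKernel b (t - s) * rlKernel a s) =
      rlKernel b (t - s) * rlKernel a s * Real.log s := by rw [rlKernelDeriv]; ring
  have hp := mul_pos (rlKernel_pos hb (sub_pos.2 hs.2)) (rlKernel_pos ha hs.1)
  simp only [Pi.add_apply]
  rw [e, norm_mul, Real.norm_of_nonneg hp.le, Real.norm_eq_abs]
  ring

theorem integral_rlKernel_mul_efrosTerm (ha : 0 < a) (hb : 0 < b) (ht : 0 < t) (n : ℕ) :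
    ∫ s in Ioo 0 t, rlKernel b (t - s) * efrosTerm a n s =
      harmonic n * rlKernel (b + a * (n + 1)) t + a * rlKernelDeriv (b + a * (n + 1)) t := by
  have hn : 0 < a * ((n : ℝ) + 1) := by positivity
  obtain ⟨h1, h2⟩ := integral_rlKernel_mul_rlKernel hb hn ht
  obtain ⟨h3, h4⟩ := integral_rlKernel_mul_rlKernelDeriv hb hn ht
  have e : ∀ s, rlKernel b (t - s) * efrosTerm a n s =
      harmonic n * (rlKernel b (t - s) * rlKernel (a * (n + 1)) s) +
        a * (rlKernel b (t - s) * rlKernelDeriv (a * (n + 1)) s) := fun s => by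
    rw [efrosTerm]; ring
  simp only [e]
  rw [integral_add (h1.const_mul _) (h3.const_mul _), integral_const_mul, integral_const_mul, h2, h4]

/-- The convolution of a function of Prabhakar type with the transform of
`exp (λ x) (log x + γ₀)`. -/
theorem prabhakar_convolution_efrosTransform (ha : 0 < a) (ha1 : a ≤ 1) (hb : 0 < b) (ht : 0 < t)
    (g lam : ℝ) :
    IntegrableOn (fun s => (t - s) ^ (b - 1) * prabhakar a b g (lam * (t - s) ^ a) *
      efrosTransform a
        (fun x => Real.exp (lam * x) * (Real.log x + Real.eulerMascheroniConstant)) s) (Ioo 0 t) ∧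
    HasSum (fun p : ℕ × ℕ => risingBinom g p.1 * lam ^ (p.1 + p.2) *
        (harmonic p.2 * rlKernel (a * (p.1 + p.2 : ℕ) + (b + a)) t +
          a * rlKernelDeriv (a * (p.1 + p.2 : ℕ) + (b + a)) t))
      (∫ s in Ioo 0 t, (t - s) ^ (b - 1) * prabhakar a b g (lam * (t - s) ^ a) *
      efrosTransform a
        (fun x => Real.exp (lam * x) * (Real.log x + Real.eulerMascheroniConstant)) s) := by
  have hR : 1 ≤ |g| + 1 := by linarith [abs_nonneg g]
  -- The double series is integrated at once over pairs, with the product of the two single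
  -- majorants.
  have hC : Summable fun p : ℕ × ℕ => mlBound a b ((|g| + 1) * |lam|) t p.1 *
      ((2 + |realDigamma a|) * mlBound a a |lam| t p.2) :=
    (summable_mlBound ha hb (by positivity) ht.le).mul_of_nonneg
      ((summable_mlBound ha ha (by positivity) ht.le).mul_left _)
      (fun k => mlBound_nonneg ha hb (by positivity) ht.le k)
      (fun k => mul_nonneg (by positivity) (mlBound_nonneg ha ha (by positivity) ht.le k))
  have hle : ∀ p : ℕ × ℕ, ∀ s ∈ Ioo 0 t,
      |(risingBinom g p.1 * lam ^ p.1 * rlKernel (a * p.1 + b) (t - s)) *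
        (lam ^ p.2 * efrosTerm a p.2 s)| ≤
      mlBound a b ((|g| + 1) * |lam|) t p.1 * ((2 + |realDigamma a|) * mlBound a a |lam| t p.2) *
        (rlKernel b (t - s) * (rlKernel a s * (1 + |Real.log s|))) := by
    intro p s hs
    have hs' : 0 < t - s := sub_pos.2 hs.2
    have h1 := abs_mul_rlKernel_le (lam := lam) (T := t) ha hb hs' (by linarith [hs.1]) hR
      (abs_risingBinom_le_succ hR (by linarith : |g| ≤ |g| + 1) p.1)
    have h2 := abs_efrosTerm_le (lam := lam) ha ha1 hs.1 hs.2.le p.2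
    rw [abs_mul]
    refine (mul_le_mul h1 h2 (abs_nonneg _) ((abs_nonneg _).trans h1)).trans (le_of_eq ?_)
    ring
  have h := hasSum_integral_of_le_mul (S := Ioo 0 t) measurableSet_Ioo
    (F := fun s => (t - s) ^ (b - 1) * prabhakar a b g (lam * (t - s) ^ a) *
      efrosTransform a
        (fun x => Real.exp (lam * x) * (Real.log x + Real.eulerMascheroniConstant)) s)
    hC (integrableOn_rlKernel_mul_log ha hb ht) (fun p => ?_) hle (fun s hs => ?_)
  · refine ⟨h.1, h.2.congr_fun fun p => ?_⟩
    have hk : 0 < a * p.1 + b := by positivity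
    have e : ∀ s, (risingBinom g p.1 * lam ^ p.1 * rlKernel (a * p.1 + b) (t - s)) *
        (lam ^ p.2 * efrosTerm a p.2 s) = risingBinom g p.1 * lam ^ (p.1 + p.2) *
        (rlKernel (a * p.1 + b) (t - s) * efrosTerm a p.2 s) := fun s => by rw [pow_add]; ring
    have e2 : a * p.1 + b + a * (p.2 + 1) = a * (p.1 + p.2 : ℕ) + (b + a) := by push_cast; ring
    simp only [e]
    rw [integral_const_mul, integral_rlKernel_mul_efrosTerm ha hk ht, e2]
  · exact (((measurable_rlKernel.comp (measurable_const.sub measurable_id)).const_mul _).mul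
      ((measurable_efrosTerm p.2).const_mul _)).aestronglyMeasurable
  · have hs' : 0 < t - s := sub_pos.2 hs.2
    refine (hasSum_prabhakar ha hb hs' g lam).mul (hasSum_efrosTransform ha ha1 hs.1 lam) ?_
    exact Summable.of_norm_bounded (hC.mul_right _) fun p => hle p s hs

end Series

/-! ### Collecting powers and conclusion -/

theorem HasSum.antidiagonal {f : ℕ × ℕ → ℝ} {S : ℝ} (h : HasSum f S) :
    HasSum (fun N => ∑ p ∈ Finset.HasAntidiagonal.antidiagonal N, f p) S := by
  rw [← Finset.HasAntidiagonal.sigmaAntidiagonalEquivProd.hasSum_iff] at h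
  refine h.sigma fun N => ?_
  have := (Finset.HasAntidiagonal.antidiagonal N).hasSum f
  exact this

end

theorem mainTheorem12 (α β γ lam : ℝ) (hα : 0 < α) (hα1 : α ≤ 1) (hβ : 1 < β) (hγ : 0 < γ) :
    -- for `α < 1` the integrals that define the kernel and its action converge absolutely
    (α < 1 → ∀ t₁ : ℝ, 0 < t₁ →
      (∀ t₂ : ℝ, 0 < t₂ →
        MeasureTheory.IntegrableOn (efrosKernelIntegrand α 0 t₁ t₂) (Set.Ioi 0)) ∧
      MeasureTheory.IntegrableOn
        (fun t₂ : ℝ => efrosKernel α 0 t₁ t₂ *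
          (Real.exp (lam * t₂) * (Real.log t₂ + Real.eulerMascheroniConstant)))
        (Set.Ioi 0)) ∧
    ∀ t : ℝ, 0 ≤ t →
      -- both convolution integrals converge absolutely
      IntervalIntegrable
        (fun t₁ : ℝ => (Real.log (t - t₁) + Real.eulerMascheroniConstant) *
          (t₁ ^ (β - 2) * prabhakar α (β - 1) γ (lam * t₁ ^ α)))
        MeasureTheory.volume 0 t ∧
      IntervalIntegrable
        (fun t₁ : ℝ => (t - t₁) ^ (β - α - 1) *
          prabhakar α (β - α) (γ - 1) (lam * (t - t₁) ^ α) *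
          efrosTransform α
            (fun t₂ => Real.exp (lam * t₂) * (Real.log t₂ + Real.eulerMascheroniConstant)) t₁)
        MeasureTheory.volume 0 t ∧
      -- the derivative with respect to `γ` exists and is given by the formula
      HasDerivAt (fun g : ℝ => t ^ (β - 1) * prabhakar α β g (lam * t ^ α))
        (-(α * ∫ t₁ in (0 : ℝ)..t, (Real.log (t - t₁) + Real.eulerMascheroniConstant) *
            (t₁ ^ (β - 2) * prabhakar α (β - 1) γ (lam * t₁ ^ α)))
          + ∫ t₁ in (0 : ℝ)..t, (t - t₁) ^ (β - α - 1) *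
            prabhakar α (β - α) (γ - 1) (lam * (t - t₁) ^ α) *
            efrosTransform α
              (fun t₂ => Real.exp (lam * t₂) * (Real.log t₂ + Real.eulerMascheroniConstant)) t₁)
        γ := by
  refine ⟨fun h t₁ ht₁ => ⟨fun t₂ _ => integrableOn_efrosKernelIntegrand hα h ht₁ t₂,
    integrableOn_efrosKernel_mul_exp_mul_log hα h ht₁ lam _⟩, fun t ht => ?_⟩
  rcases ht.eq_or_lt with rfl | ht
  · refine ⟨IntervalIntegrable.refl, IntervalIntegrable.refl, ?_⟩
    -- At t = 0 the differentiated function is identically zero, because β > 1 gives 0^(β-1) = 0.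
    simp only [intervalIntegral.integral_same, mul_zero, neg_zero, add_zero,
      Real.zero_rpow (by linarith : β - 1 ≠ 0), zero_mul]
    exact hasDerivAt_const _ _
  have e2 : β - 2 = β - 1 - 1 := by ring
  rw [e2]
  obtain ⟨h1, h2⟩ := log_convolution_prabhakar hα (by linarith : 0 < β - 1) ht γ lam
  obtain ⟨h3, h4⟩ := prabhakar_convolution_efrosTransform hα hα1 (by linarith : 0 < β - α) ht
    (γ - 1) lam
  obtain ⟨h5, h6⟩ := hasDerivAt_prabhakar hα (by linarith : 0 < β) ht γ lam
  rw [← intervalIntegrable_iff_integrableOn_Ioo_of_le ht.le] at h1 h3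
  rw [← MeasureTheory.integral_Ioc_eq_integral_Ioo, ← intervalIntegral.integral_of_le ht.le] at h2 h4
  refine ⟨h1, h3, h6.congr_deriv ?_⟩
  refine (h5.hasSum.unique ?_)
  have h7 := (h2.mul_left α).neg.add h4.antidiagonal
  refine h7.congr_fun fun N => ?_
  -- On an antidiagonal the kernels depend only on N, so the coefficient sums factor out.
  have e3 : ∀ p ∈ Finset.HasAntidiagonal.antidiagonal N,
      risingBinom (γ - 1) p.1 * lam ^ (p.1 + p.2) *
        (harmonic p.2 * rlKernel (α * (p.1 + p.2 : ℕ) + (β - α + α)) t +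
          α * rlKernelDeriv (α * (p.1 + p.2 : ℕ) + (β - α + α)) t) =
      risingBinom (γ - 1) p.1 * harmonic p.2 * (lam ^ N * rlKernel (α * N + β) t) +
        risingBinom (γ - 1) p.1 * (lam ^ N * (α * rlKernelDeriv (α * N + β) t)) := by
    intro p hp
    rw [Finset.HasAntidiagonal.mem_antidiagonal.1 hp, sub_add_cancel]
    ring
  -- The h' sum becomes α (γ)_N/N! λ^N h'_{αN+β} and cancels the first convolution; the harmonic sum
  -- is the derivative coefficient.
  rw [Finset.sum_congr rfl e3, Finset.sum_add_distrib, ← Finset.sum_mul, ← Finset.sum_mul,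
    sum_risingBinom, sum_risingBinom_mul_harmonic, sub_add_cancel]
  ring
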